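/- Let $J_2$ be the Janko group of order $604800$ (the Hall--Janko group). For conjugacy classes $C_1,C_2,C_3$ of a finite group $G$, say that $G$ is $(C_1,C_2,C_3)$-generated if there are $a\in C_1$ and $b\in C_2$ with $ab\in C_3$ and $\langle a,b\rangle=G$; equivalently, for a fixed $c\in C_3$ the number $\xi^*_G(C_1,C_2,C_3)$ of ordered pairs $(a,b)\in C_1\times C_2$ with $ab=c$ and $\langle a,b\rangle=G$ is positive. Conjugacy classes of $J_2$ are named as in the ATLAS of Finite Groups: $2A$ and $2B$ are the classes of elements of order $2$ with centralizers of order $1920$ and $240$ respectively; $3A$ and $3B$ are the classes of elements of order $3$ with centralizers of order $1080$ and $36$ respectively; $5A$ is either one of the two classes of elements of order $5$ with centralizer of order $300$; $5C$ is either one of the two classes of elements of order $5$ with centralizer of order $50$; and $7A$ is the class of elements of order $7$, whose centralizers have order $7$. Classes with these properties exist, and, whichever of the two classes is chosen as $5A$ and whichever of the two is chosen as $5C$, the following hold. (a) $J_2$ is $(2B,3B,7A)$-, $(2A,5C,7A)$-, $(2B,5A,7A)$-, $(2B,5C,7A)$-, $(3A,5C,7A)$-, $(3B,5A,7A)$-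 and $(3B,5C,7A)$-generated. (b) $J_2$ is not $(2A,3A,7A)$-, $(2A,3B,7A)$-, $(2B,3A,7A)$-, $(2A,5A,7A)$- or $(3A,5A,7A)$-generated. -/

import Mathlib

/-! ## Conjugacy classes and generation -/

/-- For a finite group `G`, classes `C₁`, `C₂` and an element `c`: the number of ordered pairs
`(a, b)` with `a ∈ C₁`, `b ∈ C₂`, `a * b = c` and `⟨a, b⟩ = G`. -/
noncomputable def xiStar {G : Type*} [Group G] [Finite G] (C₁ C₂ : ConjClasses G) (c : G) : ℕ :=
  Nat.card {p : G × G // p.1 ∈ C₁.carrier ∧ p.2 ∈ C₂.carrier ∧ p.1 * p.2 = c ∧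
    Subgroup.closure {p.1, p.2} = ⊤}

/-- `G` is `(C₁, C₂, C₃)`-generated: `xiStar` is positive for a representative `c` of `C₃`
(the value does not depend on the choice of the representative). -/
def IsClassGenerated {G : Type*} [Group G] [Finite G] (C₁ C₂ C₃ : ConjClasses G) : Prop :=
  ∃ c ∈ C₃.carrier, 0 < xiStar C₁ C₂ c

/-- `C` consists of elements of order `n` whose centralizer in `G` has order `k`. -/
def HasOrderAndCentralizer {G : Type*} [Group G] (n k : ℕ) (C : ConjClasses G) : Prop :=
  ∀ x ∈ C.carrier, orderOf x = n ∧ Nat.card (Subgroup.centralizer ({x} : Set G)) = k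

/-! ## The Janko group `J₂` -/

/-- The permutation of the points `1, …, 100` which is the product of the given cycles, each
mapping an entry to the next one and the last to the first. The points are written as elements
of `Fin 100`, so that the numeral `100` denotes the same point as `0`. -/
def permOfCycles (l : List (List (Fin 100))) : Equiv.Perm (Fin 100) :=
  (l.map List.formPerm).prod

/-- First standard generator of `J₂` (an element of the class `2B`) on 100 points. -/
def janko2GenA : Equiv.Perm (Fin 100) := permOfCycles
  [[1, 84], [2, 20], [3, 48], [4, 56], [5, 82], [6, 67], [7, 55], [8, 41], [9, 35],
   [10, 40], [11, 78], [12, 100], [13, 49], [14, 37], [15, 94], [16, 76], [17, 19],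
   [18, 44], [21, 34], [22, 85], [23, 92], [24, 57], [25, 75], [26, 28], [27, 64],
   [29, 90], [30, 97], [31, 38], [32, 68], [33, 69], [36, 53], [39, 61], [42, 73],
   [43, 91], [45, 86], [46, 81], [47, 89], [50, 93], [51, 96], [52, 72], [54, 74],
   [58, 99], [59, 95], [60, 63], [62, 83], [65, 70], [66, 88], [71, 87], [77, 98],
   [79, 80]]

/-- Second standard generator of `J₂` (an element of the class `3B`) on 100 points. -/
def janko2GenB : Equiv.Perm (Fin 100) := permOfCycles
  [[1, 80, 22], [2, 9, 11], [3, 53, 87], [4, 23, 78], [5, 51, 18], [6, 37, 24],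
   [8, 27, 60], [10, 62, 47], [12, 65, 31], [13, 64, 19], [14, 61, 52], [15, 98, 25],
   [16, 73, 32], [17, 39, 33], [20, 97, 58], [21, 96, 67], [26, 93, 99], [28, 57, 35],
   [29, 71, 55], [30, 69, 45], [34, 86, 82], [38, 59, 94], [40, 43, 91], [42, 68, 44],
   [46, 85, 89], [48, 76, 90], [49, 92, 77], [50, 66, 88], [54, 95, 56], [63, 74, 72],
   [70, 81, 75], [79, 100, 83]]

/-- The Janko group `J₂` (Hall–Janko group), of order 604800, in its transitive rank 3
representation on 100 points: point stabilizer `U₃(3)`, suborbits of lengths 1, 36, 63. It is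
generated by standard generators `a ∈ 2B`, `b ∈ 3B` with `ab` of order 7 and `[a, b]` of
order 12. -/
def Janko2 : Subgroup (Equiv.Perm (Fin 100)) :=
  Subgroup.closure {janko2GenA, janko2GenB}

/-- A choice of conjugacy classes of `J₂` bearing the ATLAS names `2A`, `2B`, `3A`, `3B`, `5A`,
`5C`, `7A`. ATLAS names consist of the order of the elements and a letter, the letters following
the decreasing order of the centralizers. The classes `2A`, `2B`, `3A`, `3B`, `7A` are determined
by this. The classes of elements of order 5 are `5A`, `5B` (centralizers of order 300) and
`5C`, `5D` (centralizers of order 50); which class of such a pair of algebraically conjugate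
classes comes first is a convention, and both choices are admitted. -/
structure Janko2AtlasClasses where
  cl2A : ConjClasses Janko2
  cl2B : ConjClasses Janko2
  cl3A : ConjClasses Janko2
  cl3B : ConjClasses Janko2
  cl5A : ConjClasses Janko2
  cl5C : ConjClasses Janko2
  cl7A : ConjClasses Janko2
  spec2A : HasOrderAndCentralizer 2 1920 cl2A
  spec2B : HasOrderAndCentralizer 2 240 cl2B
  spec3A : HasOrderAndCentralizer 3 1080 cl3A
  spec3B : HasOrderAndCentralizer 3 36 cl3B
  spec5A : HasOrderAndCentralizer 5 300 cl5A
  spec5C : HasOrderAndCentralizer 5 50 cl5C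
  spec7A : HasOrderAndCentralizer 7 7 cl7A

/-! ## Permutations of 100 points as natural numbers -/

/-- The `i`-th digit of `c` in base 256. -/
def digit (c i : ℕ) : ℕ := Nat.land (Nat.shiftRight c (Nat.mul 8 i)) 255

/-- The number with base 256 digits `f 0, …, f (k - 1)`. -/
noncomputable def ofDigitFun (f : ℕ → ℕ) (k : ℕ) : ℕ :=
  Nat.rec 0 (fun n r => Nat.add r (Nat.shiftLeft (f n) (Nat.mul 8 n))) k

/-- The code of a permutation: its values are the base 256 digits. -/
noncomputable def code (σ : Equiv.Perm (Fin 100)) : ℕ :=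
  ofDigitFun (fun n => if h : n < 100 then (σ ⟨n, h⟩).val else 0) 100

/-- Product of permutations, on codes. -/
noncomputable def mulc (c d : ℕ) : ℕ := ofDigitFun (fun n => digit c (digit d n)) 100

/-- Inverse of a permutation, on codes. -/
noncomputable def invc (c : ℕ) : ℕ :=
  Nat.rec 0 (fun n r => Nat.add r (Nat.shiftLeft n (Nat.mul 8 (digit c n)))) 100

/-- The code of the identity. -/
noncomputable def onec : ℕ := ofDigitFun (fun n => n) 100

theorem digit_eq (c i : ℕ) : digit c i = c / 256 ^ i % 256 := by
  have h1 : Nat.land (Nat.shiftRight c (Nat.mul 8 i)) 255 = (c >>> (8 * i)) &&& (2 ^ 8 - 1) := rfl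
  rw [digit, h1, Nat.and_two_pow_sub_one_eq_mod, Nat.shiftRight_eq_div_pow, pow_mul]
  norm_num

theorem ofDigitFun_zero (f : ℕ → ℕ) : ofDigitFun f 0 = 0 := rfl

theorem ofDigitFun_succ (f : ℕ → ℕ) (k : ℕ) :
    ofDigitFun f (k + 1) = ofDigitFun f k + f k * 256 ^ k := by
  have : ofDigitFun f (k + 1) = ofDigitFun f k + (f k) <<< (8 * k) := rfl
  rw [this, Nat.shiftLeft_eq, pow_mul]
  norm_num

theorem ofDigitFun_eq_sum (f : ℕ → ℕ) (k : ℕ) :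
    ofDigitFun f k = ∑ n ∈ Finset.range k, f n * 256 ^ n := by
  induction k with
  | zero => rfl
  | succ k ih => rw [ofDigitFun_succ, ih, Finset.sum_range_succ]

theorem ofDigitFun_lt {f : ℕ → ℕ} {k : ℕ} (hf : ∀ n < k, f n < 256) : ofDigitFun f k < 256 ^ k := by
  induction k with
  | zero => simp [ofDigitFun_zero]
  | succ k ih =>
    rw [ofDigitFun_succ, pow_succ]
    have h1 := ih fun n hn => hf n (by omega)
    have h2 : f k * 256 ^ k ≤ 255 * 256 ^ k := Nat.mul_le_mul_right _ (by have := hf k (by omega); omega)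
    omega

theorem digit_ofDigitFun {f : ℕ → ℕ} {k i : ℕ} (hf : ∀ n < k, f n < 256) (hi : i < k) :
    digit (ofDigitFun f k) i = f i := by
  rw [digit_eq]
  induction k with
  | zero => omega
  | succ k ih =>
    rw [ofDigitFun_succ]
    rcases Nat.lt_succ_iff_lt_or_eq.mp hi with h | rfl
    · obtain ⟨m, rfl⟩ : ∃ m, k = i + (m + 1) := ⟨k - i - 1, by omega⟩
      have : f (i + (m + 1)) * 256 ^ (i + (m + 1)) = (f (i + (m + 1)) * 256 ^ m * 256) * 256 ^ i := by
        ring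
      rw [this, Nat.add_mul_div_right _ _ (by positivity), Nat.add_mul_mod_self_right]
      exact ih (fun n hn => hf n (by omega)) h
    · rw [Nat.add_mul_div_right _ _ (by positivity),
        Nat.div_eq_of_lt (ofDigitFun_lt fun n hn => hf n (by omega)), zero_add,
        Nat.mod_eq_of_lt (hf i (by omega))]

theorem ofDigitFun_congr {f g : ℕ → ℕ} {k : ℕ} (h : ∀ n < k, f n = g n) :
    ofDigitFun f k = ofDigitFun g k := by
  rw [ofDigitFun_eq_sum, ofDigitFun_eq_sum]
  exact Finset.sum_congr rfl fun n hn => by rw [h n (Finset.mem_range.mp hn)]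

theorem digit_code (σ : Equiv.Perm (Fin 100)) (i : Fin 100) : digit (code σ) i = σ i := by
  rw [code, digit_ofDigitFun _ i.2]
  · simp
  · intro n hn
    simp only [hn, dif_pos]
    have := (σ ⟨n, hn⟩).2
    omega

theorem digit_code_lt (σ : Equiv.Perm (Fin 100)) {n : ℕ} (hn : n < 100) :
    digit (code σ) n < 100 := by
  have := digit_code σ ⟨n, hn⟩
  simp only at this
  rw [this]
  exact (σ ⟨n, hn⟩).2

theorem code_injective : Function.Injective code := by
  intro σ τ h
  ext i
  rw [← digit_code, ← digit_code, h]

theorem code_eq_ofDigitFun {σ : Equiv.Perm (Fin 100)} {f : ℕ → ℕ} (h : ∀ i : Fin 100, (σ i : ℕ) = f i) :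
    code σ = ofDigitFun f 100 :=
  ofDigitFun_congr fun n hn => by simp only [hn, dif_pos]; exact h ⟨n, hn⟩

theorem mulc_code (σ τ : Equiv.Perm (Fin 100)) : mulc (code σ) (code τ) = code (σ * τ) := by
  symm
  apply code_eq_ofDigitFun
  intro i
  rw [digit_code, digit_code]
  rfl

theorem onec_eq : onec = code 1 := (code_eq_ofDigitFun fun _ => rfl).symm

theorem code_eq_sum (σ : Equiv.Perm (Fin 100)) : code σ = ∑ i : Fin 100, (σ i : ℕ) * 256 ^ (i : ℕ) := by
  rw [code, ofDigitFun_eq_sum, ← Fin.sum_univ_eq_sum_range (fun n => (if h : n < 100 then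
    (σ ⟨n, h⟩).val else 0) * 256 ^ n) 100]
  simp

/-- `invc` writes `n` at position `σ n`, so its digits arrive out of order. Both sides are therefore
compared as sums, which differ by reindexing along `σ`. -/
theorem invc_code (σ : Equiv.Perm (Fin 100)) : invc (code σ) = code σ⁻¹ := by
  have h : ∀ (c k : ℕ), (Nat.rec 0 (fun n r => Nat.add r (Nat.shiftLeft n (Nat.mul 8 (digit c n)))) k : ℕ)
      = ∑ n ∈ Finset.range k, n * 256 ^ digit c n := by
    intro c k
    induction k with
    | zero => rfl
    | succ k ih =>
      rw [Finset.sum_range_succ, ← ih]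
      have : k * 256 ^ digit c k = k <<< (8 * digit c k) := by
        rw [Nat.shiftLeft_eq, pow_mul]
        norm_num
      rw [this]
      rfl
  rw [invc, h, ← Fin.sum_univ_eq_sum_range (fun n => n * 256 ^ digit (code σ) n) 100,
    code_eq_sum σ⁻¹, ← Equiv.sum_comp σ fun i => ((σ⁻¹ i : Fin 100) : ℕ) * 256 ^ (i : ℕ)]
  simp [digit_code]

/-! ## Forced evaluation, and bounded searches on lists -/

/-- `force n f = f n`, where the kernel evaluates `n` first. -/
def force {α : Type} (n : ℕ) (f : ℕ → α) : α := Nat.rec (f 0) (fun k _ => f (Nat.succ k)) n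

@[simp] theorem force_eq {α : Type} (n : ℕ) (f : ℕ → α) : force n f = f n := by
  cases n <;> rfl

/-- `forceList l f = f l`, where the kernel evaluates the entries of `l` first. -/
def forceList (l : List ℕ) : (List ℕ → Bool) → Bool :=
  List.rec (motive := fun _ => (List ℕ → Bool) → Bool) (fun f => f [])
    (fun a _ ih f => force a fun b => ih fun m => f (b :: m)) l

@[simp] theorem forceList_eq (l : List ℕ) (f : List ℕ → Bool) : forceList l f = f l := by
  induction l generalizing f with
  | nil => rfl
  | cons a l ih =>
    have : forceList (a :: l) f = force a fun b => forceList l fun m => f (b :: m) := rfl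
    rw [this, force_eq, ih]

/-- Some entry of the list satisfies `f`. -/
def anyc (l : List ℕ) (f : ℕ → Bool) : Bool :=
  List.rec (motive := fun _ => Bool) false (fun a _ ih => cond (f a) true ih) l

@[simp] theorem anyc_eq_true (l : List ℕ) (f : ℕ → Bool) :
    anyc l f = true ↔ ∃ a ∈ l, f a = true := by
  induction l with
  | nil => simp [anyc]
  | cons a l ih =>
    have : anyc (a :: l) f = cond (f a) true (anyc l f) := rfl
    rw [this]
    cases h : f a <;> simp [ih, h]

/-- All entries of the list satisfy `f`. -/
def allc (l : List ℕ) (f : ℕ → Bool) : Bool :=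
  List.rec (motive := fun _ => Bool) true (fun a _ ih => cond (f a) ih false) l

@[simp] theorem allc_eq_true (l : List ℕ) (f : ℕ → Bool) :
    allc l f = true ↔ ∀ a ∈ l, f a = true := by
  induction l with
  | nil => simp [allc]
  | cons a l ih =>
    have : allc (a :: l) f = cond (f a) (allc l f) false := rfl
    rw [this]
    cases h : f a <;> simp [ih, h]

/-- Corresponding entries of two lists of the same length satisfy `f`. -/
def allZip (l m : List ℕ) (f : ℕ → ℕ → Bool) : Bool :=
  List.rec (motive := fun _ => List ℕ → Bool)
    (fun m => List.rec (motive := fun _ => Bool) true (fun _ _ _ => false) m)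
    (fun a _ ih m => List.rec (motive := fun _ => Bool) false
      (fun b m _ => cond (f a b) (ih m) false) m) l m

theorem exists_of_allZip {l m : List ℕ} {f : ℕ → ℕ → Bool} (h : allZip l m f = true) :
    ∀ a ∈ l, ∃ b, f a b = true := by
  induction l generalizing m with
  | nil => simp
  | cons a l ih =>
    cases m with
    | nil => exact absurd h (by simp [allZip])
    | cons b m =>
      have h' : cond (f a b) (allZip l m f) false = true := h
      cases hf : f a b
      · simp [hf] at h'
      · rw [hf] at h'
        intro c hc
        rcases List.mem_cons.mp hc with rfl | hc
        · exact ⟨b, hf⟩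
        · exact ih h' c hc

/-- The sum of the values of `f` on the list. -/
def sumc (l : List ℕ) (f : ℕ → ℕ) : ℕ :=
  List.rec (motive := fun _ => ℕ) 0 (fun a _ ih => Nat.add (f a) ih) l

theorem sumc_eq (l : List ℕ) (f : ℕ → ℕ) : sumc l f = (l.map f).sum := by
  induction l with
  | nil => rfl
  | cons a l ih =>
    have : sumc (a :: l) f = f a + sumc l f := rfl
    rw [this, ih, List.map_cons, List.sum_cons]

/-- Membership in a list of numbers. -/
def memc (l : List ℕ) (a : ℕ) : Bool := anyc l (Nat.beq a)

@[simp] theorem memc_eq_true (l : List ℕ) (a : ℕ) : memc l a = true ↔ a ∈ l := by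
  simp [memc, Nat.beq_eq]

/-- The list has no repeated entries. -/
def nodupc (l : List ℕ) : Bool :=
  List.rec (motive := fun _ => Bool) true (fun a l ih => cond (memc l a) false ih) l

@[simp] theorem nodupc_eq_true (l : List ℕ) : nodupc l = true ↔ l.Nodup := by
  induction l with
  | nil => simp [nodupc]
  | cons a l ih =>
    have : nodupc (a :: l) = cond (memc l a) false (nodupc l) := rfl
    rw [this, List.nodup_cons, ← ih, ← memc_eq_true]
    cases memc l a <;> simp

/-- All points `n < 100` satisfy `f`. -/
def allPoints (f : ℕ → Bool) : Bool :=
  Nat.rec (motive := fun _ => Bool) true (fun n ih => cond (f n) ih false) 100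

@[simp] theorem allPoints_eq_true (f : ℕ → Bool) :
    allPoints f = true ↔ ∀ i : Fin 100, f i = true := by
  have h : ∀ k, (Nat.rec (motive := fun _ => Bool) true (fun n ih => cond (f n) ih false) k) = true ↔
      ∀ n < k, f n = true := by
    intro k
    induction k with
    | zero => simp
    | succ k ih =>
      simp only
      cases hf : f k
      · simp only [cond_false, Bool.false_eq_true, false_iff, not_forall]
        exact ⟨k, by omega, by simp [hf]⟩
      · rw [cond_true, ih]
        constructor
        · intro h n hn
          rcases Nat.lt_succ_iff_lt_or_eq.mp hn with h' | rfl
          exacts [h n h', hf]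
        · exact fun h n hn => h n (by omega)
  rw [allPoints, h]
  exact ⟨fun h i => h i i.2, fun h n hn => h ⟨n, hn⟩⟩

/-- The `n`-th entry of a list, with default value `d`. -/
def nth (d : ℕ) (l : List ℕ) (n : ℕ) : ℕ :=
  List.rec (motive := fun _ => ℕ → ℕ) (fun _ => d)
    (fun a _ ih n => Nat.rec (motive := fun _ => ℕ) a (fun m _ => ih m) n) l n

/-- An index out of range gives the default. As the defaults used below are themselves codes of
admissible permutations, programs and numberings need no bounds checks. -/
theorem nth_mem_cons (d : ℕ) (l : List ℕ) (n : ℕ) : nth d l n ∈ d :: l := by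
  induction l generalizing n with
  | nil => simp [nth]
  | cons a l ih =>
    cases n with
    | zero => simp [nth]
    | succ n =>
      have : nth d (a :: l) (n + 1) = nth d l n := rfl
      rw [this]
      rcases List.mem_cons.mp (ih n) with h | h <;> simp [h]

/-- The codes `k`, `x`, `y` of permutations satisfy `k * x = y * k`. -/
def intertwines (k x y : ℕ) : Bool :=
  allPoints fun n => Nat.beq (digit k (digit x n)) (digit y (digit k n))

theorem intertwines_code (σ τ υ : Equiv.Perm (Fin 100)) :
    intertwines (code σ) (code τ) (code υ) = true ↔ σ * τ = υ * σ := by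
  simp [intertwines, digit_code, Nat.beq_eq, Equiv.ext_iff, Fin.ext_iff]

/-- The `p`-th power of `c` is the identity. -/
def powIsOne (p c : ℕ) : Bool :=
  allPoints fun n => Nat.beq (Nat.rec (motive := fun _ => ℕ) n (fun _ r => digit c r) p) n

theorem powIsOne_code (p : ℕ) (σ : Equiv.Perm (Fin 100)) :
    powIsOne p (code σ) = true ↔ σ ^ p = 1 := by
  have h : ∀ i : Fin 100, (Nat.rec (motive := fun _ => ℕ) (i : ℕ) (fun _ r => digit (code σ) r) p)
      = ((σ ^ p) i : ℕ) := by
    intro i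
    induction p with
    | zero => rfl
    | succ p ih =>
      simp only
      rw [ih, digit_code, pow_succ']
      rfl
  simp only [powIsOne, allPoints_eq_true, Nat.beq_eq, h, Equiv.ext_iff, Fin.ext_iff,
    Equiv.Perm.one_apply]

/-! ## Straight-line programs -/

/-- The list of values of a straight-line program, the last one first: an instruction `n` applies the
operation with number `n % 4` to the value computed `n / 4` steps before the last one. -/
def slp (op : ℕ → ℕ → ℕ) (d : ℕ) : List ℕ → List ℕ → List ℕ
  | [], l => l
  | n :: s, l => force (op (Nat.mod n 4) (nth d l (Nat.div n 4))) fun c => slp op d s (c :: l)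

/-- All entries of the list are codes of permutations with the property `P`. -/
def CodesIn (P : Equiv.Perm (Fin 100) → Prop) (l : List ℕ) : Prop :=
  ∀ c ∈ l, ∃ σ, P σ ∧ code σ = c

theorem CodesIn.nth {P : Equiv.Perm (Fin 100) → Prop} {l : List ℕ} (h : CodesIn P l) {d : ℕ}
    (hd : ∃ σ, P σ ∧ code σ = d) (n : ℕ) : ∃ σ, P σ ∧ code σ = nth d l n := by
  rcases List.mem_cons.mp (nth_mem_cons d l n) with h' | h'
  · rwa [h']
  · exact h _ h'

/-- Soundness of programs: a property preserved by the operation holds for all values, whatever the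
instructions are. -/
theorem codesIn_slp {P : Equiv.Perm (Fin 100) → Prop} {op : ℕ → ℕ → ℕ} {d : ℕ}
    (hop : ∀ k σ, P σ → ∃ τ, P τ ∧ code τ = op k (code σ)) (hd : ∃ σ, P σ ∧ code σ = d)
    (s : List ℕ) {l : List ℕ} (hl : CodesIn P l) : CodesIn P (slp op d s l) := by
  induction s generalizing l with
  | nil => exact hl
  | cons n s ih =>
    rw [slp, force_eq]
    apply ih
    intro c hc
    rcases List.mem_cons.mp hc with rfl | hc
    · obtain ⟨σ, hσ, h⟩ := hl.nth hd (Nat.div n 4)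
      rw [← h]
      exact hop _ σ hσ
    · exact hl c hc

/-- All values of a straight-line program of left multiplications with the entries of `g`, starting
from the identity. -/
noncomputable def products (g s : List ℕ) : List ℕ :=
  slp (fun k x => mulc (nth onec g k) x) onec s [onec]

theorem codesIn_products {K : Subgroup (Equiv.Perm (Fin 100))} {g : List ℕ}
    (hg : CodesIn (· ∈ K) g) (s : List ℕ) : CodesIn (· ∈ K) (products g s) := by
  have h1 : ∃ σ, σ ∈ K ∧ code σ = onec := ⟨1, K.one_mem, onec_eq.symm⟩
  refine codesIn_slp ?_ h1 s ?_
  · intro k σ hσ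
    obtain ⟨τ, hτ, h⟩ := hg.nth h1 k
    exact ⟨τ * σ, K.mul_mem hτ hσ, by rw [← h, mulc_code]⟩
  · intro c hc
    rw [List.mem_singleton.mp hc]
    exact h1

/-- The last value of a straight-line program of left multiplications. -/
noncomputable def wordc (g s : List ℕ) : ℕ := nth onec (products g s) 0

theorem exists_code_eq_wordc {K : Subgroup (Equiv.Perm (Fin 100))} {g : List ℕ}
    (hg : CodesIn (· ∈ K) g) (s : List ℕ) : ∃ σ, σ ∈ K ∧ code σ = wordc g s :=
  (codesIn_products hg s).nth ⟨1, K.one_mem, onec_eq.symm⟩ 0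

/-! ## A chain of point stabilizers in `J₂` -/

/-- The code of `janko2GenA`. -/
def genA : ℕ :=
  0x3a4d1e333b0f32172b1d2f42472d16013e052e4f500b621019362a34574121200658461b3c53273f5f631804074a2448605d0d03595156125b49080a3d1f0e350915454426615a1a401c4b395c552202112c134c5e2531004e282329374352383014540c

/-- The code of `janko2GenB`. -/
def genB : ℕ :=
  0x1a193a433826634d28302e32035259544f224b160004315a4648203f37512d2c15581f134a2f34085e1423361d5f570e12425c4c0a551e2a5b44292b213b18241c5611100c4547393c5d0f064e0160610d052749623d4041023e0b1b0725331735095053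

/-- Program for elements of `J₂` mapping `0` to the points `0, …, 99`, from `janko2GenA`, `janko2GenB`. -/
def script0 : List ℕ :=
  [0, 5, 5, 4, 9, 8, 13, 13, 12, 13, 12, 12, 17, 17, 16, 21, 21, 16, 16, 21, 16, 16, 21, 21, 16,
   17, 17, 12, 9, 8, 13, 8, 9, 8, 9, 8, 13, 13, 12, 8, 8, 13, 13, 13, 13, 12, 12, 17, 16, 21,
   20, 25, 25, 20, 21, 20, 21, 20, 20, 16, 21, 21, 20, 25, 25, 21, 20, 20, 16, 13, 9, 9, 8, 8,
   8, 13, 13, 13, 8, 8, 8, 9, 0, 1, 0, 5, 5, 1, 0, 1, 0, 5, 5, 4, 4, 9, 9, 4, 4]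

/-- Word for the first generator of the stabilizer of `0`. -/
def word0a : List ℕ :=
  [0, 1, 0, 1, 0, 1, 0, 1, 1, 0, 1]

/-- Word for the second generator of the stabilizer of `0`. -/
def word0b : List ℕ :=
  [1, 0, 1, 0, 1, 1, 0, 1, 1, 0, 1]

/-- Program for elements of the stabilizer of `0` mapping `1` to the 63 points of its orbit. -/
def script1 : List ℕ :=
  [0, 5, 4, 9, 8, 13, 13, 12, 17, 16, 21, 20, 25, 24, 29, 28, 28, 33, 33, 32, 37, 33, 32, 37,
   36, 41, 41, 40, 40, 45, 44, 49, 48, 53, 52, 49, 49, 48, 53, 48, 53, 53, 52, 57, 52, 52, 48,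
   53, 49, 49, 44, 49, 49, 44, 37, 32, 32, 24, 29, 28, 24, 13]

/-- Word for the first generator of the stabilizer of `0` and `1`. -/
def word1a : List ℕ :=
  [1, 1, 0, 1]

/-- Word for the second generator of the stabilizer of `0` and `1`. -/
def word1b : List ℕ :=
  [0, 1, 1, 0, 1, 1]

/-- Program for the elements of the stabilizer of `0` and `1`. -/
def script2 : List ℕ :=
  [0, 5, 4, 9, 8, 13, 13, 12, 17, 16, 21, 20, 25, 24, 29, 28, 33, 32, 37, 37, 36, 41, 40, 45,
   44, 44, 49, 48, 53, 53, 52, 57, 56, 61, 60, 61, 60, 65, 64, 69, 69, 68, 73, 72, 77, 77, 76,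
   76, 76, 77, 76, 77, 77, 77, 76, 81, 81, 81, 81, 81, 77, 77, 76, 81, 81, 80, 85, 85, 84, 85,
   85, 81, 72, 77, 77, 76, 81, 77, 77, 73, 73, 65, 65, 64, 69, 65, 61, 61, 53, 53, 52, 57, 25,
   24, 29]

/-- The generators of `J₂`. -/
def gens0 : List ℕ := [genA, genB]

/-- Generators of the stabilizer of `0`. -/
noncomputable def gens1 : List ℕ := [wordc gens0 word0a, wordc gens0 word0b]

/-- Generators of the stabilizer of `0` and `1`. -/
noncomputable def gens2 : List ℕ := [wordc gens1 word1a, wordc gens1 word1b]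

/-- Representatives of the left cosets of the stabilizer of `0`. -/
noncomputable def tab0 : List ℕ := products gens0 script0

/-- Representatives of the left cosets of the stabilizer of `1` in the stabilizer of `0`. -/
noncomputable def tab1 : List ℕ := products gens1 script1

/-- The elements of the stabilizer of `0` and `1`. -/
noncomputable def tab2 : List ℕ := products gens2 script2

/-- Evaluates the generators and the three tables before passing them on. -/
noncomputable def withTables (f : List ℕ → List ℕ → List ℕ → List ℕ → List ℕ → Bool) : Bool :=
  forceList gens1 fun g => forceList gens2 fun k =>
    forceList (products gens0 script0) fun u => forceList (products g script1) fun v =>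
      forceList (products k script2) fun h => f g k u v h

theorem withTables_eq (f : List ℕ → List ℕ → List ℕ → List ℕ → List ℕ → Bool) :
    withTables f = f gens1 gens2 tab0 tab1 tab2 := by
  simp [withTables, tab0, tab1, tab2]

/-- The code `w` is the product of the entry of `l` which agrees with `w` at the point `b` with an
element satisfying `f`. -/
noncomputable def sift (l : List ℕ) (b : ℕ) (f : ℕ → Bool) (w : ℕ) : Bool :=
  anyc l fun t => cond (Nat.beq (digit t b) (digit w b)) (force (mulc (invc t) w) f) false

/-- The tables describe a stabilizer chain. -/
noncomputable def chainCheck (g k u v h : List ℕ) : Bool :=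
  allc k (fun s => allc h fun t => force (mulc s t) (memc h)) &&
  allc g (fun s => allc v fun t => force (mulc s t) (sift v 1 (memc h))) &&
  allc gens0 (fun s => allc u fun t => force (mulc s t) (sift u 0 (sift v 1 (memc h)))) &&
  (memc h onec && memc v onec && memc u onec) &&
  nodupc (u.map fun c => digit c 0) &&
  (allc v (fun c => Nat.beq (digit c 0) 0) && nodupc (v.map fun c => digit c 1)) &&
  (allc h (fun c => Nat.beq (digit c 0) 0 && Nat.beq (digit c 1) 1) && nodupc h) &&
  (Nat.beq u.length 100 && Nat.beq v.length 63 && Nat.beq h.length 96)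

/-! ### Verification of the chain and factorization of the elements -/

theorem code_janko2GenA : code janko2GenA = genA := by decide +kernel

theorem code_janko2GenB : code janko2GenB = genB := by decide +kernel

theorem withTables_chainCheck : withTables chainCheck = true := by decide +kernel

/-- If every generator maps every element of `T` into `T K`, then the generated group is
contained in `T K`. -/
theorem exists_mem_inv_mul_mem {G : Type*} [Group G] [Finite G] {S : Set G} {T : Set G}
    {K : Subgroup G} (h1 : 1 ∈ T) (h : ∀ s ∈ S, ∀ t ∈ T, ∃ t' ∈ T, t'⁻¹ * (s * t) ∈ K) {g : G}
    (hg : g ∈ Subgroup.closure S) : ∃ t ∈ T, t⁻¹ * g ∈ K := by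
  have key : ∀ s ∈ S, ∀ x, (∃ t ∈ T, t⁻¹ * x ∈ K) → ∃ t ∈ T, t⁻¹ * (s * x) ∈ K := by
    rintro s hs x ⟨t, ht, hx⟩
    obtain ⟨t', ht', h'⟩ := h s hs t ht
    refine ⟨t', ht', ?_⟩
    have := K.mul_mem h' hx
    rwa [show t'⁻¹ * (s * t) * (t⁻¹ * x) = t'⁻¹ * (s * x) by group] at this
  induction hg using Subgroup.closure_induction_left with
  | one => exact ⟨1, h1, by simp⟩
  | mul_left s hs x _ ih => exact key s hs x ih
  | inv_mul_cancel s hs x _ ih =>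
    have hpow : ∀ n : ℕ, ∃ t ∈ T, t⁻¹ * (s ^ n * x) ∈ K := by
      intro n
      induction n with
      | zero => simpa using ih
      | succ n ihn =>
        rw [pow_succ', mul_assoc]
        exact key s hs _ ihn
    -- In a finite group the inverse of a generator is a positive power of it, so only generators
    -- have to be tested.
    have hs' : s⁻¹ = s ^ (orderOf s - 1) := by
      rw [inv_eq_iff_mul_eq_one, ← pow_succ', Nat.sub_add_cancel (orderOf_pos s), pow_orderOf_eq_one]
    rw [hs']
    exact hpow _

theorem genA_mem : janko2GenA ∈ Janko2 := Subgroup.subset_closure (by simp)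

theorem genB_mem : janko2GenB ∈ Janko2 := Subgroup.subset_closure (by simp)

theorem codesIn_gens0 : CodesIn (· ∈ Janko2) gens0 := by
  intro c hc
  simp only [gens0, List.mem_cons, List.not_mem_nil, or_false] at hc
  rcases hc with rfl | rfl
  · exact ⟨_, genA_mem, code_janko2GenA⟩
  · exact ⟨_, genB_mem, code_janko2GenB⟩

theorem codesIn_pair {K : Subgroup (Equiv.Perm (Fin 100))} {g : List ℕ}
    (hg : CodesIn (· ∈ K) g) (s t : List ℕ) : CodesIn (· ∈ K) [wordc g s, wordc g t] := by
  intro c hc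
  simp only [List.mem_cons, List.not_mem_nil, or_false] at hc
  rcases hc with rfl | rfl
  · exact exists_code_eq_wordc hg s
  · exact exists_code_eq_wordc hg t

theorem codesIn_gens1 : CodesIn (· ∈ Janko2) gens1 := codesIn_pair codesIn_gens0 _ _

theorem codesIn_gens2 : CodesIn (· ∈ Janko2) gens2 := codesIn_pair codesIn_gens1 _ _

theorem codesIn_tab0 : CodesIn (· ∈ Janko2) tab0 := codesIn_products codesIn_gens0 _

theorem codesIn_tab1 : CodesIn (· ∈ Janko2) tab1 := codesIn_products codesIn_gens1 _

theorem codesIn_tab2 : CodesIn (· ∈ Janko2) tab2 := codesIn_products codesIn_gens2 _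

theorem exists_of_sift {l : List ℕ} {b : ℕ} {f : ℕ → Bool} {σ : Equiv.Perm (Fin 100)}
    {P : Equiv.Perm (Fin 100) → Prop} (hl : CodesIn P l) (h : sift l b f (code σ) = true) :
    ∃ t, code t ∈ l ∧ f (code (t⁻¹ * σ)) = true := by
  simp only [sift, anyc_eq_true, force_eq] at h
  obtain ⟨c, hc, h⟩ := h
  obtain ⟨t, -, rfl⟩ := hl c hc
  refine ⟨t, hc, ?_⟩
  cases hb : Nat.beq (digit (code t) b) (digit (code σ) b)
  · simp [hb] at h
  · simpa [hb, invc_code, mulc_code] using h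

theorem chainCheck_tables : chainCheck gens1 gens2 tab0 tab1 tab2 = true := by
  rw [← withTables_eq chainCheck]
  exact withTables_chainCheck

theorem nodup_tab0 : (tab0.map fun c => digit c 0).Nodup := by
  have h := chainCheck_tables
  simp only [chainCheck, Bool.and_eq_true, nodupc_eq_true] at h
  exact h.1.1.1.2

theorem nodup_tab1 : (tab1.map fun c => digit c 1).Nodup := by
  have h := chainCheck_tables
  simp only [chainCheck, Bool.and_eq_true, nodupc_eq_true] at h
  exact h.1.1.2.2

theorem nodup_tab2 : tab2.Nodup := by
  have h := chainCheck_tables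
  simp only [chainCheck, Bool.and_eq_true, nodupc_eq_true] at h
  exact h.1.2.2

theorem digit_tab1 : ∀ c ∈ tab1, digit c 0 = 0 := by
  have h := chainCheck_tables
  simp only [chainCheck, Bool.and_eq_true, allc_eq_true, Nat.beq_eq] at h
  exact h.1.1.2.1

theorem digit_tab2 : ∀ c ∈ tab2, digit c 0 = 0 ∧ digit c 1 = 1 := by
  have h := chainCheck_tables
  simp only [chainCheck, Bool.and_eq_true, allc_eq_true, Nat.beq_eq] at h
  exact h.1.2.1

theorem length_tab0 : tab0.length = 100 := by
  have h := chainCheck_tables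
  simp only [chainCheck, Bool.and_eq_true, Nat.beq_eq] at h
  exact h.2.1.1

theorem length_tab1 : tab1.length = 63 := by
  have h := chainCheck_tables
  simp only [chainCheck, Bool.and_eq_true, Nat.beq_eq] at h
  exact h.2.1.2

theorem length_tab2 : tab2.length = 96 := by
  have h := chainCheck_tables
  simp only [chainCheck, Bool.and_eq_true, Nat.beq_eq] at h
  exact h.2.2

theorem onec_mem : onec ∈ tab2 ∧ onec ∈ tab1 ∧ onec ∈ tab0 := by
  have h := chainCheck_tables
  simp only [chainCheck, Bool.and_eq_true, memc_eq_true] at h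
  exact ⟨h.1.1.1.1.2.1.1, h.1.1.1.1.2.1.2, h.1.1.1.1.2.2⟩

/-- The permutations with code in the given list. -/
def permsOf (l : List ℕ) : Set (Equiv.Perm (Fin 100)) := {σ | code σ ∈ l}

/-- With `K = ⊥` the criterion says that a list containing the identity and closed under left
multiplication by the generators contains the whole generated group. -/
theorem mem_tab2_of_mem_closure {g : Equiv.Perm (Fin 100)}
    (hg : g ∈ Subgroup.closure (permsOf gens2)) : code g ∈ tab2 := by
  have hc := chainCheck_tables
  simp only [chainCheck, Bool.and_eq_true, allc_eq_true, memc_eq_true, force_eq] at hc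
  obtain ⟨t, ht, h⟩ := exists_mem_inv_mul_mem (T := permsOf tab2) (K := ⊥)
    (by simpa [permsOf, ← onec_eq] using onec_mem.1)
    (fun s hs t ht => ⟨s * t, by
      have := hc.1.1.1.1.1.1.1 _ hs _ ht
      rwa [mulc_code] at this, by simp⟩) hg
  have : t = g := by simpa [Subgroup.mem_bot, inv_mul_eq_one] using h
  rwa [← this]

theorem codesIn_closure_gens {g : List ℕ} {P : Equiv.Perm (Fin 100) → Prop} (hg : CodesIn P g) :
    CodesIn (· ∈ Subgroup.closure (permsOf g)) g := by
  intro c hc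
  obtain ⟨σ, -, rfl⟩ := hg c hc
  exact ⟨σ, Subgroup.subset_closure hc, rfl⟩

theorem mem_closure_of_code_mem {g s : List ℕ} {P : Equiv.Perm (Fin 100) → Prop}
    (hg : CodesIn P g) {σ : Equiv.Perm (Fin 100)} (hσ : code σ ∈ products g s) :
    σ ∈ Subgroup.closure (permsOf g) := by
  obtain ⟨τ, hτ, h⟩ := codesIn_products (codesIn_closure_gens hg) s _ hσ
  rwa [← code_injective h]

theorem exists_factorization_of_mem_closure {g : Equiv.Perm (Fin 100)}
    (hg : g ∈ Subgroup.closure (permsOf gens1)) :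
    ∃ v h, code v ∈ tab1 ∧ code h ∈ tab2 ∧ g = v * h := by
  have hc := chainCheck_tables
  simp only [chainCheck, Bool.and_eq_true, allc_eq_true, force_eq] at hc
  obtain ⟨t, ht, h⟩ := exists_mem_inv_mul_mem (T := permsOf tab1)
    (K := Subgroup.closure (permsOf gens2)) (by simpa [permsOf, ← onec_eq] using onec_mem.2.1)
    (fun s hs t ht => by
      have := hc.1.1.1.1.1.1.2 _ hs _ ht
      rw [mulc_code] at this
      obtain ⟨t', ht', h'⟩ := exists_of_sift codesIn_tab1 this
      exact ⟨t', ht', mem_closure_of_code_mem codesIn_gens2 ((memc_eq_true _ _).mp h')⟩) hg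
  exact ⟨t, t⁻¹ * g, ht, mem_tab2_of_mem_closure h, by group⟩

/-- Schreier's criterion at the top of the chain: each `t'⁻¹ * s * t` sifts through `tab1` into
`tab2`, hence lies in the group generated by `gens1`, whose elements factor in turn. -/
theorem exists_factorization {g : Equiv.Perm (Fin 100)} (hg : g ∈ Janko2) :
    ∃ u v h, code u ∈ tab0 ∧ code v ∈ tab1 ∧ code h ∈ tab2 ∧ g = u * v * h := by
  have hc := chainCheck_tables
  simp only [chainCheck, Bool.and_eq_true, allc_eq_true, force_eq] at hc
  have hgen : ∀ s ∈ ({janko2GenA, janko2GenB} : Set (Equiv.Perm (Fin 100))), code s ∈ gens0 := by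
    rintro s (rfl | rfl)
    · simp [code_janko2GenA, gens0]
    · simp [code_janko2GenB, gens0]
  obtain ⟨t, ht, h⟩ := exists_mem_inv_mul_mem (T := permsOf tab0)
    (K := Subgroup.closure (permsOf gens1)) (by simpa [permsOf, ← onec_eq] using onec_mem.2.2)
    (fun s hs t ht => by
      have := hc.1.1.1.1.1.2 _ (hgen s hs) _ ht
      rw [mulc_code] at this
      obtain ⟨t', ht', h'⟩ := exists_of_sift codesIn_tab0 this
      obtain ⟨v, hv, h''⟩ := exists_of_sift codesIn_tab1 h'
      refine ⟨t', ht', ?_⟩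
      rw [← mul_inv_cancel_left v (t'⁻¹ * (s * t))]
      refine Subgroup.mul_mem _ (mem_closure_of_code_mem codesIn_gens1 hv) ?_
      -- The generators at the bottom level are words in those of the level above.
      have hle : Subgroup.closure (permsOf gens2) ≤ Subgroup.closure (permsOf gens1) := by
        rw [Subgroup.closure_le]
        intro σ hσ
        obtain ⟨τ, hτ, h⟩ := codesIn_pair (codesIn_closure_gens codesIn_gens1) word1a word1b _ hσ
        rwa [← code_injective h]
      exact hle (mem_closure_of_code_mem codesIn_gens2 ((memc_eq_true _ _).mp h''))) hg
  obtain ⟨v, w, hv, hw, h'⟩ := exists_factorization_of_mem_closure h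
  exact ⟨t, v, w, ht, hv, hw, by rw [mul_assoc, ← h']; group⟩

theorem mem_janko2_of_code_mem {l : List ℕ} (hl : CodesIn (· ∈ Janko2) l)
    {σ : Equiv.Perm (Fin 100)} (h : code σ ∈ l) : σ ∈ Janko2 := by
  obtain ⟨τ, hτ, h⟩ := hl _ h
  rwa [← code_injective h]

/-! ## The list of all elements -/

/-- The codes of the elements of `J₂`. -/
noncomputable def elementCodes : List ℕ :=
  tab0.flatMap fun u => tab1.flatMap fun v => tab2.map fun h => mulc (mulc u v) h

theorem mem_elementCodes {c : ℕ} : c ∈ elementCodes ↔ ∃ g ∈ Janko2, code g = c := by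
  simp only [elementCodes, List.mem_flatMap, List.mem_map]
  constructor
  · rintro ⟨u, hu, v, hv, h, hh, rfl⟩
    obtain ⟨u, hu', rfl⟩ := codesIn_tab0 u hu
    obtain ⟨v, hv', rfl⟩ := codesIn_tab1 v hv
    obtain ⟨h, hh', rfl⟩ := codesIn_tab2 h hh
    exact ⟨u * v * h, mul_mem (mul_mem hu' hv') hh', by simp only [mulc_code]⟩
  · rintro ⟨g, hg, rfl⟩
    obtain ⟨u, v, h, hu, hv, hh, rfl⟩ := exists_factorization hg
    exact ⟨_, hu, _, hv, _, hh, by simp only [mulc_code]⟩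

theorem digit_mulc_code (σ τ : Equiv.Perm (Fin 100)) (i : Fin 100) :
    digit (mulc (code σ) (code τ)) i = digit (code σ) (digit (code τ) i) := by
  rw [mulc_code, digit_code, digit_code, digit_code]
  rfl

theorem digit_zero_product {u v h : ℕ} (hu : u ∈ tab0) (hv : v ∈ tab1) (hh : h ∈ tab2) :
    digit (mulc (mulc u v) h) 0 = digit u 0 := by
  have h1 := digit_tab1 v hv
  have h2 := (digit_tab2 h hh).1
  obtain ⟨u, hu', rfl⟩ := codesIn_tab0 u hu
  obtain ⟨v, hv', rfl⟩ := codesIn_tab1 v hv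
  obtain ⟨h, hh', rfl⟩ := codesIn_tab2 h hh
  have e1 := digit_mulc_code (u * v) h 0
  have e2 := digit_mulc_code u v 0
  simp only [Fin.val_zero] at e1 e2
  rw [mulc_code u v, e1, h2, ← mulc_code, e2, h1]

theorem digit_one_product {u v h : ℕ} (hu : u ∈ tab0) (hv : v ∈ tab1) (hh : h ∈ tab2) :
    digit (mulc (mulc u v) h) 1 = digit u (digit v 1) := by
  have h2 := (digit_tab2 h hh).2
  obtain ⟨u, hu', rfl⟩ := codesIn_tab0 u hu
  obtain ⟨v, hv', rfl⟩ := codesIn_tab1 v hv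
  obtain ⟨h, hh', rfl⟩ := codesIn_tab2 h hh
  have e1 := digit_mulc_code (u * v) h 1
  have e2 := digit_mulc_code u v 1
  simp only [Fin.val_one] at e1 e2
  rw [mulc_code u v, e1, h2, ← mulc_code, e2]

theorem digit_injective_of_codesIn {P : Equiv.Perm (Fin 100) → Prop} {l : List ℕ}
    (hl : CodesIn P l) {c m n : ℕ} (hc : c ∈ l) (hm : m < 100) (hn : n < 100)
    (h : digit c m = digit c n) : m = n := by
  obtain ⟨σ, -, rfl⟩ := hl c hc
  have h1 := digit_code σ ⟨m, hm⟩
  have h2 := digit_code σ ⟨n, hn⟩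
  simp only at h1 h2
  rw [h1, h2, ← Fin.ext_iff] at h
  simpa using σ.injective h

theorem digit_lt_of_codesIn {P : Equiv.Perm (Fin 100) → Prop} {l : List ℕ}
    (hl : CodesIn P l) {c m : ℕ} (hc : c ∈ l) (hm : m < 100) : digit c m < 100 := by
  obtain ⟨σ, -, rfl⟩ := hl c hc
  exact digit_code_lt σ hm

theorem mulc_left_cancel {a b c : Equiv.Perm (Fin 100)}
    (h : mulc (code a) (code b) = mulc (code a) (code c)) : b = c := by
  rw [mulc_code, mulc_code] at h
  exact mul_left_cancel (code_injective h)

/-- The base images recover the factors: the image of 0 determines `u`, then the image of 1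
determines `v`, and `h` follows by cancellation. -/
theorem nodup_elementCodes : elementCodes.Nodup := by
  rw [elementCodes, List.nodup_flatMap]
  refine ⟨fun u hu => ?_, ?_⟩
  · rw [List.nodup_flatMap]
    refine ⟨fun v hv => ?_, ?_⟩
    · refine nodup_tab2.map_on ?_
      intro h hh h' hh' e
      obtain ⟨u, hu', rfl⟩ := codesIn_tab0 u hu
      obtain ⟨v, hv', rfl⟩ := codesIn_tab1 v hv
      obtain ⟨h, -, rfl⟩ := codesIn_tab2 h hh
      obtain ⟨h', -, rfl⟩ := codesIn_tab2 h' hh'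
      rw [mulc_code u v] at e
      rw [mulc_left_cancel e]
    · have := nodup_tab1
      rw [List.Nodup, List.pairwise_map] at this
      refine this.imp_of_mem ?_
      intro v v' hv hv' hne c hc hc'
      obtain ⟨h, hh, rfl⟩ := List.mem_map.mp hc
      obtain ⟨h', hh', e⟩ := List.mem_map.mp hc'
      apply hne
      have := congrArg (digit · 1) e
      simp only [digit_one_product hu hv hh, digit_one_product hu hv' hh'] at this
      exact (digit_injective_of_codesIn codesIn_tab0 hu
        (digit_lt_of_codesIn codesIn_tab1 hv' (by norm_num))
        (digit_lt_of_codesIn codesIn_tab1 hv (by norm_num)) this).symm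
  · have := nodup_tab0
    rw [List.Nodup, List.pairwise_map] at this
    refine this.imp_of_mem ?_
    intro u u' hu hu' hne c hc hc'
    simp only [List.mem_flatMap, List.mem_map] at hc hc'
    obtain ⟨v, hv, h, hh, rfl⟩ := hc
    obtain ⟨v', hv', h', hh', e⟩ := hc'
    apply hne
    have := congrArg (digit · 0) e
    simp only [digit_zero_product hu hv hh, digit_zero_product hu' hv' hh'] at this
    exact this.symm

/-- The number of elements of `J₂` whose codes satisfy a predicate. -/
theorem card_subtype_eq_countP (p : ℕ → Bool) (P : Janko2 → Prop)
    (h : ∀ g : Janko2, P g ↔ p (code g) = true) :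
    Nat.card {g : Janko2 // P g} = elementCodes.countP p := by
  have hmem : ∀ c, c ∈ (elementCodes.filter p).toFinset ↔ ∃ g : Janko2, P g ∧ code g = c := by
    intro c
    rw [List.mem_toFinset, List.mem_filter, mem_elementCodes]
    constructor
    · rintro ⟨⟨g, hg, rfl⟩, hp⟩
      exact ⟨⟨g, hg⟩, (h ⟨g, hg⟩).mpr hp, rfl⟩
    · rintro ⟨g, hg, rfl⟩
      exact ⟨⟨g, g.2, rfl⟩, (h g).mp hg⟩
  let F : {g : Janko2 // P g} → (elementCodes.filter p).toFinset :=
    fun g => ⟨code g.1, (hmem _).mpr ⟨g.1, g.2, rfl⟩⟩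
  have hF : Function.Bijective F := by
    constructor
    · intro g g' e
      have e' : code g.1.1 = code g'.1.1 := by
        simpa only [F, Subtype.mk.injEq] using e
      exact Subtype.ext (Subtype.ext (code_injective e'))
    · rintro ⟨c, hc⟩
      obtain ⟨g, hg, rfl⟩ := (hmem c).mp hc
      exact ⟨⟨g, hg⟩, rfl⟩
  rw [Nat.card_congr (Equiv.ofBijective F hF), Nat.card_eq_fintype_card, Fintype.card_coe,
    List.toFinset_card_of_nodup (nodup_elementCodes.filter _), List.countP_eq_length_filter]

theorem card_janko2 : Nat.card Janko2 = 604800 := by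
  have h := card_subtype_eq_countP (fun _ => true) (fun _ => True) (by simp)
  rw [List.countP_true] at h
  have h2 : elementCodes.length = 604800 := by
    simp [elementCodes, List.length_flatMap, length_tab0, length_tab1, length_tab2]
  rw [← h2, ← h]
  exact Nat.card_congr (Equiv.subtypeUnivEquiv fun _ => trivial).symm

/-! ## Numbering of the elements -/

/-- The code of the element number `n`, given the three tables. -/
noncomputable def element (u v h : List ℕ) (n : ℕ) : ℕ :=
  mulc (mulc (nth onec u (Nat.mod n 100)) (nth onec v (Nat.mod (Nat.div n 100) 63)))
    (nth onec h (Nat.div n 6300))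

theorem exists_code_eq_element (n : ℕ) : ∃ g : Janko2, code g = element tab0 tab1 tab2 n := by
  have h1 : ∃ σ, σ ∈ Janko2 ∧ code σ = onec := ⟨1, Janko2.one_mem, onec_eq.symm⟩
  obtain ⟨u, hu, eu⟩ := codesIn_tab0.nth h1 (Nat.mod n 100)
  obtain ⟨v, hv, ev⟩ := codesIn_tab1.nth h1 (Nat.mod (Nat.div n 100) 63)
  obtain ⟨h, hh, eh⟩ := codesIn_tab2.nth h1 (Nat.div n 6300)
  exact ⟨⟨u * v * h, mul_mem (mul_mem hu hv) hh⟩, by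
    rw [element, ← eu, ← ev, ← eh, mulc_code, mulc_code]⟩

/-- The element of `J₂` with number `n`. -/
noncomputable def elt (n : ℕ) : Janko2 := (exists_code_eq_element n).choose

theorem code_elt (n : ℕ) : code (elt n) = element tab0 tab1 tab2 n :=
  (exists_code_eq_element n).choose_spec

theorem codesIn_map_element (l : List ℕ) :
    CodesIn (· ∈ Janko2) (l.map (element tab0 tab1 tab2)) := by
  intro c hc
  obtain ⟨n, -, rfl⟩ := List.mem_map.mp hc
  exact ⟨elt n, (elt n).2, code_elt n⟩

/-! ## Orders of centralizers -/

/-- The number of elements commuting with the element with code `t`, which maps `0` to `1`. -/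
noncomputable def centralizerCount (u v h : List ℕ) (t : ℕ) : ℕ :=
  sumc u fun a => sumc v fun b => cond (Nat.beq (digit a (digit b 1)) (digit t (digit a 0)))
    (force (mulc a b) fun w => sumc h fun c => cond (allPoints fun n =>
      Nat.beq (digit w (digit c (digit t n))) (digit t (digit w (digit c n)))) 1 0) 0

/-- The element number `n` maps `0` to `1` and has a centralizer of order `k`. -/
noncomputable def centralizerCheck (n k : ℕ) : Bool :=
  withTables fun _ _ u v h => force (element u v h n) fun t =>
    Nat.beq (digit t 0) 1 && Nat.beq (centralizerCount u v h t) k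

theorem List.sum_map_cond {α : Type*} (l : List α) (p : α → Bool) :
    (l.map fun a => cond (p a) 1 0).sum = l.countP p := by
  induction l with
  | nil => rfl
  | cons a l ih =>
    rw [List.map_cons, List.sum_cons, ih, List.countP_cons]
    cases p a <;> simp [add_comm]

theorem allPoints_commute (a b c t : Equiv.Perm (Fin 100)) :
    (allPoints fun n => Nat.beq (digit (code (a * b)) (digit (code c) (digit (code t) n)))
      (digit (code t) (digit (code (a * b)) (digit (code c) n)))) =
    intertwines (code (a * b * c)) (code t) (code t) := by
  rw [Bool.eq_iff_iff, allPoints_eq_true, intertwines_code]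
  simp [digit_code, Nat.beq_eq, Equiv.ext_iff, Fin.ext_iff]

/-- If `g = u * v * h` commutes with `t` and `t` maps 0 to 1, then `g 1 = t (g 0)`, that is, `u (v
1) = t (u 0)`. This does not involve `h`, so most pairs `u`, `v` are discarded before any of the 96
elements `h` is tried. -/
theorem card_centralizer_eq_count (t : Janko2) (ht : digit (code t) 0 = 1) :
    Nat.card (Subgroup.centralizer ({t} : Set Janko2)) =
      centralizerCount tab0 tab1 tab2 (code t) := by
  have h1 : Nat.card (Subgroup.centralizer ({t} : Set Janko2)) =
      elementCodes.countP fun c => intertwines c (code t) (code t) :=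
    card_subtype_eq_countP _ _ fun g => by
      rw [intertwines_code, Subgroup.mem_centralizer_singleton_iff, ← Subgroup.coe_mul,
        ← Subgroup.coe_mul, Subtype.ext_iff]
  rw [h1, elementCodes, List.countP_flatMap, centralizerCount, sumc_eq]
  refine congrArg List.sum (List.map_congr_left fun u hu => ?_)
  rw [Function.comp_apply, List.countP_flatMap, sumc_eq]
  refine congrArg List.sum (List.map_congr_left fun v hv => ?_)
  rw [Function.comp_apply, List.countP_map]
  have hu' := hu
  have hv' := hv
  obtain ⟨a, ha, rfl⟩ := codesIn_tab0 u hu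
  obtain ⟨b, hb, rfl⟩ := codesIn_tab1 v hv
  cases hd : Nat.beq (digit (code a) (digit (code b) 1)) (digit (code t) (digit (code a) 0))
  -- The test on base images fails, so no element of the coset `a * b * h` can commute with `t`.
  · rw [cond_false, List.countP_eq_zero]
    intro h hh hcomm
    have hh' := hh
    obtain ⟨c, hc, rfl⟩ := codesIn_tab2 h hh
    rw [Function.comp_apply, mulc_code, mulc_code, intertwines_code] at hcomm
    have e1 := digit_one_product hu' hv' hh'
    have e0 := digit_zero_product hu' hv' hh'
    rw [mulc_code, mulc_code] at e0 e1
    have e2 := digit_mulc_code (a * b * c) t 0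
    have e3 := digit_mulc_code t (a * b * c) 0
    rw [mulc_code] at e2 e3
    rw [Fin.val_zero] at e2 e3
    rw [hcomm, e3, ht, e0, e1] at e2
    rw [← e2, ← Bool.not_eq_true, Nat.beq_eq] at hd
    exact hd rfl
  · rw [cond_true, force_eq, sumc_eq, List.sum_map_cond]
    refine List.countP_congr fun h hh => ?_
    obtain ⟨c, hc, rfl⟩ := codesIn_tab2 h hh
    rw [Function.comp_apply, mulc_code, mulc_code, allPoints_commute]

theorem card_centralizer_of_check {n k : ℕ} (h : centralizerCheck n k = true) :
    Nat.card (Subgroup.centralizer ({elt n} : Set Janko2)) = k := by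
  rw [centralizerCheck, withTables_eq, force_eq, ← code_elt, Bool.and_eq_true, Nat.beq_eq,
    Nat.beq_eq] at h
  rw [card_centralizer_eq_count _ h.1, h.2]

/-! ## Sylow subgroups and fusion -/

theorem orderOf_eq_of_isConj {G : Type*} [Group G] {x y : G} (h : IsConj x y) :
    orderOf x = orderOf y := by
  obtain ⟨c, rfl⟩ := isConj_iff.mp h
  exact (MulEquiv.orderOf_eq (MulAut.conj c) x).symm

/-- The elements numbered by `gens` generate a group of order `m`, whose elements are listed by the
program `s`, and each element of order `p` in it is conjugate to an element numbered by `reps`, by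
the element numbered by the corresponding entry of `conj`. -/
noncomputable def sylowCheck (p m : ℕ) (gens s conj reps : List ℕ) : Bool :=
  withTables fun _ _ u v h => forceList (gens.map (element u v h)) fun g =>
    forceList (products g s) fun l => forceList (reps.map (element u v h)) fun r =>
      allc g (fun a => allc l fun b => force (mulc a b) (memc l)) && memc l onec && nodupc l &&
      Nat.beq l.length m &&
      allZip l conj fun c n => cond (powIsOne p c && !(Nat.beq c onec))
        (force (element u v h n) fun k => anyc r fun t => intertwines k c t) true

open scoped Pointwise in
-- The listed group has order a power of p and index prime to p, so it is a Sylow subgroup. By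
-- Sylow's theorems every element of order p has a conjugate in it, and the check covers each of its
-- elements of order p.
theorem isConj_of_sylowCheck {p m e : ℕ} [Fact p.Prime] {gens s conj reps : List ℕ}
    (h : sylowCheck p m gens s conj reps = true) (hm : m = p ^ e) (hdvd : m ∣ 604800)
    (hp : ¬ p ∣ 604800 / m) {g : Janko2} (hg : orderOf g = p) : ∃ n ∈ reps, IsConj g (elt n) := by
  rw [sylowCheck, withTables_eq] at h
  simp only [forceList_eq, force_eq, Bool.and_eq_true, allc_eq_true, memc_eq_true, nodupc_eq_true,
    Nat.beq_eq] at h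
  obtain ⟨⟨⟨⟨hclosed, hone⟩, hnodup⟩, hlen⟩, hconj⟩ := h
  set gs := gens.map (element tab0 tab1 tab2) with hgs
  set l := products gs s with hl
  have hgsJ : CodesIn (· ∈ Janko2) gs := codesIn_map_element gens
  set K := Subgroup.closure (permsOf gs) with hK
  have hKl : ∀ σ, σ ∈ K ↔ code σ ∈ l := by
    intro σ
    refine ⟨fun hσ => ?_, fun hσ => mem_closure_of_code_mem hgsJ hσ⟩
    obtain ⟨t, ht, h⟩ := exists_mem_inv_mul_mem (T := permsOf l) (K := ⊥)
      (by simpa [permsOf, ← onec_eq] using hone)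
      (fun s hs t ht => ⟨s * t, by
        have := hclosed _ hs _ ht
        rwa [mulc_code] at this, by simp⟩) hσ
    have : t = σ := by simpa [Subgroup.mem_bot, inv_mul_eq_one] using h
    rwa [← this]
  have hKJ : K ≤ Janko2 := by
    rw [hK, Subgroup.closure_le]
    exact fun σ hσ => mem_janko2_of_code_mem hgsJ hσ
  have hcardK : Nat.card K = m := by
    have hF : Function.Bijective
        (fun σ => ⟨code σ.1, List.mem_toFinset.mpr ((hKl _).mp σ.2)⟩ : K → l.toFinset) := by
      constructor
      · intro σ τ e
        have e' : code σ.1 = code τ.1 := by simpa only [Subtype.mk.injEq] using e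
        exact Subtype.ext (code_injective e')
      · rintro ⟨c, hc⟩
        obtain ⟨σ, hσ, rfl⟩ := codesIn_products hgsJ s c (List.mem_toFinset.mp hc)
        exact ⟨⟨σ, (hKl σ).mpr (List.mem_toFinset.mp hc)⟩, rfl⟩
    rw [Nat.card_congr (Equiv.ofBijective _ hF), Nat.card_eq_fintype_card, Fintype.card_coe,
      List.toFinset_card_of_nodup hnodup, hlen]
  have hcardS : Nat.card (K.subgroupOf Janko2) = m := by
    rw [Nat.card_congr (Subgroup.subgroupOfEquivOfLe hKJ).toEquiv, hcardK]
  have hindex : (K.subgroupOf Janko2).index = 604800 / m := by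
    have := Subgroup.card_mul_index (K.subgroupOf Janko2)
    rw [hcardS, card_janko2] at this
    rw [← this, Nat.mul_div_cancel_left]
    rcases Nat.eq_zero_or_pos m with rfl | h0
    · simp at this
    · exact h0
  let P : Sylow p Janko2 := IsPGroup.toSylow (IsPGroup.of_card (hcardS.trans hm)) (by rwa [hindex])
  have hz : IsPGroup p (Subgroup.zpowers g) :=
    IsPGroup.of_card (n := 1) (by rw [Nat.card_zpowers, hg, pow_one])
  obtain ⟨Q, hQ⟩ := hz.exists_le_sylow
  obtain ⟨x, hx⟩ := MulAction.exists_smul_eq Janko2 P Q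
  have hgQ : g ∈ (x • P : Sylow p Janko2) := by
    rw [hx]
    exact hQ (Subgroup.mem_zpowers g)
  -- Membership in the conjugate `x • P` means that `x⁻¹ * g * x` lies in `P`.
  have hgP : x⁻¹ * g * x ∈ K.subgroupOf Janko2 := by
    have h3 : g ∈ MulAut.conj x • (P : Subgroup Janko2) := hgQ
    rw [Subgroup.mem_pointwise_smul_iff_inv_smul_mem, ← map_inv, MulAut.smul_def,
      MulAut.conj_apply, inv_inv] at h3
    exact h3
  obtain ⟨n, hn⟩ := exists_of_allZip hconj _ ((hKl _).mp (Subgroup.mem_subgroupOf.mp hgP))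
  have hconjg : IsConj g (x⁻¹ * g * x) := isConj_iff.mpr ⟨x⁻¹, by group⟩
  have hord : orderOf (x⁻¹ * g * x) = p := by
    rw [← hg, orderOf_eq_of_isConj hconjg]
  have hpow : (x⁻¹ * g * x) ^ p = 1 := by rw [← hord, pow_orderOf_eq_one]
  have hne : x⁻¹ * g * x ≠ 1 := by
    intro h
    rw [h, orderOf_one] at hord
    exact (Fact.out : p.Prime).one_lt.ne hord
  have h1 : powIsOne p (code (x⁻¹ * g * x : Janko2)) = true := by
    rw [powIsOne_code, ← Subgroup.coe_pow, hpow, Subgroup.coe_one]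
  have h2 : Nat.beq (code (x⁻¹ * g * x : Janko2)) onec = false := by
    rw [← Bool.not_eq_true, Nat.beq_eq, onec_eq]
    intro h
    exact hne (Subtype.ext (code_injective h))
  rw [h1, h2] at hn
  simp only [Bool.not_false, Bool.and_self, cond_true, anyc_eq_true] at hn
  obtain ⟨c, hc, hn⟩ := hn
  obtain ⟨r, hr, rfl⟩ := List.mem_map.mp hc
  refine ⟨r, hr, hconjg.trans (isConj_iff.mpr ⟨elt n, ?_⟩)⟩
  rw [← code_elt, ← code_elt, intertwines_code] at hn
  rw [mul_inv_eq_iff_eq_mul]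
  exact Subtype.ext hn

/-! ## Representatives of the classes -/

/-- The number of an element of the class `2A`. -/
def num2A : ℕ := 516614

/-- The number of an element of the class `2B`. -/
def num2B : ℕ := 180979

/-- The number of an element of the class `3A`. -/
def num3A : ℕ := 574203

/-- The number of an element of the class `3B`. -/
def num3B : ℕ := 258379

/-- The number of an element of the class `5A`. -/
def num5A : ℕ := 412179

/-- The number of an element of the class `5B`. -/
def num5B : ℕ := 284477

/-- The number of an element of the class `5C`. -/
def num5C : ℕ := 426879

/-- The number of an element of the class `5D`. -/
def num5D : ℕ := 604017

/-- The number of an element of the class `7A`. -/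
def num7A : ℕ := 331779

/-- Numbers of generators of a Sylow 2-subgroup. -/
def sylowGens2 : List ℕ :=
  [50561, 592300, 572187]

/-- Program for the elements of a Sylow 2-subgroup. -/
def sylowScript2 : List ℕ :=
  [0, 5, 10, 8, 13, 18, 16, 22, 20, 25, 30, 28, 33, 38, 36, 42, 40, 45, 50, 49, 54, 52, 57, 62,
   60, 65, 70, 68, 74, 72, 78, 76, 81, 86, 84, 90, 88, 93, 98, 98, 97, 102, 100, 105, 110, 108,
   114, 112, 118, 116, 116, 116, 121, 126, 124, 130, 128, 128, 133, 138, 136, 136, 141, 146,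
   145, 144, 150, 150, 144, 149, 154, 152, 158, 156, 161, 166, 166, 165, 170, 170, 170, 170,
   168, 168, 174, 169, 174, 172, 172, 177, 182, 181, 180, 186, 178, 178, 177, 182, 177, 177,
   176, 178, 172, 170, 168, 168, 170, 164, 157, 156, 162, 160, 165, 161, 162, 158, 144, 149,
   148, 146, 145, 144, 144, 142, 140, 138, 61]

/-- Numbers of elements conjugating the elements of order 2 to representatives. -/
def sylowConj2 : List ℕ :=
  [0, 0, 0, 602414, 0, 0, 0, 294417, 601397, 320891, 0, 0, 0, 0, 0, 0, 0, 0, 0, 0, 0, 604791, 0,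
   604080, 0, 297766, 0, 604726, 0, 0, 601384, 601779, 0, 600087, 0, 0, 378934, 603499, 0,
   600263, 0, 0, 0, 603735, 0, 223373, 0, 0, 601993, 603698, 0, 0, 0, 0, 602437, 227546, 0,
   212970, 0, 0, 0, 603773, 0, 0, 602472, 0, 0, 0, 0, 0, 0, 0, 0, 579178, 0, 0, 0, 602599, 0, 0,
   349920, 0, 0, 0, 0, 0, 0, 0, 0, 0, 0, 0, 0, 0, 0, 212993, 0, 0, 0, 212895, 0, 0, 316969, 0,
   0, 0, 599990, 0, 0, 175473, 241588, 0, 0, 604295, 0, 0, 263351, 0, 0, 0, 0, 0, 0, 0, 0,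
   521968, 0, 0]

/-- Numbers of generators of a Sylow 3-subgroup. -/
def sylowGens3 : List ℕ :=
  [116608, 503078]

/-- Program for the elements of a Sylow 3-subgroup. -/
def sylowScript3 : List ℕ :=
  [0, 5, 4, 9, 8, 13, 13, 12, 17, 16, 21, 20, 20, 25, 24, 29, 28, 25, 25, 24, 29, 28, 25, 25,
   13, 13]

/-- Numbers of elements conjugating the elements of order 3 to representatives. -/
def sylowConj3 : List ℕ :=
  [604727, 604757, 373899, 61306, 402510, 603172, 579132, 521179, 7486, 361493, 458251, 294485,
   111655, 183229, 597187, 598081, 105888, 603693, 603589, 127653, 237739, 273443, 363889,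
   340325, 128959, 206268, 0]

/-- Numbers of generators of a Sylow 5-subgroup. -/
def sylowGens5 : List ℕ :=
  [354468, 130731]

/-- Program for the elements of a Sylow 5-subgroup. -/
def sylowScript5 : List ℕ :=
  [0, 5, 4, 9, 9, 8, 13, 13, 13, 12, 17, 17, 17, 17, 17, 17, 17, 17, 13, 13, 13, 9, 9, 5]

/-- Numbers of elements conjugating the elements of order 5 to representatives. -/
def sylowConj5 : List ℕ :=
  [602473, 329654, 522487, 604171, 604696, 329654, 599185, 13471, 599185, 13471, 603887, 419965,
   602473, 522487, 246869, 603887, 604171, 419965, 74637, 525685, 604696, 246869, 525685, 74637,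
   0]

/-- Numbers of generators of a Sylow 7-subgroup. -/
def sylowGens7 : List ℕ :=
  [331779]

/-- Program for the elements of a Sylow 7-subgroup. -/
def sylowScript7 : List ℕ :=
  [0, 0, 0, 0, 0, 0]

/-- Numbers of elements conjugating the elements of order 7 to representatives. -/
def sylowConj7 : List ℕ :=
  [218426, 4871, 331058, 139794, 597273, 604799, 0]

/-! ### Centralizer orders and fusion, by evaluation -/

theorem card_centralizer_2B : Nat.card (Subgroup.centralizer ({elt num2B} : Set Janko2)) = 240 :=
  card_centralizer_of_check (by decide +kernel)

theorem card_centralizer_3B : Nat.card (Subgroup.centralizer ({elt num3B} : Set Janko2)) = 36 :=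
  card_centralizer_of_check (by decide +kernel)

theorem card_centralizer_5A : Nat.card (Subgroup.centralizer ({elt num5A} : Set Janko2)) = 300 :=
  card_centralizer_of_check (by decide +kernel)

theorem card_centralizer_5C : Nat.card (Subgroup.centralizer ({elt num5C} : Set Janko2)) = 50 :=
  card_centralizer_of_check (by decide +kernel)

theorem card_centralizer_7A : Nat.card (Subgroup.centralizer ({elt num7A} : Set Janko2)) = 7 :=
  card_centralizer_of_check (by decide +kernel)

theorem isConj_of_orderOf_eq_two {g : Janko2} (hg : orderOf g = 2) :
    IsConj g (elt num2A) ∨ IsConj g (elt num2B) := by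
  have h : sylowCheck 2 128 sylowGens2 sylowScript2 sylowConj2 [num2A, num2B] = true := by
    decide +kernel
  have : Fact (Nat.Prime 2) := ⟨by norm_num⟩
  obtain ⟨n, hn, hc⟩ := isConj_of_sylowCheck (e := 7) h (by norm_num) (by norm_num) (by norm_num) hg
  simp only [List.mem_cons, List.not_mem_nil, or_false] at hn
  rcases hn with rfl | rfl
  exacts [Or.inl hc, Or.inr hc]

theorem isConj_of_orderOf_eq_three {g : Janko2} (hg : orderOf g = 3) :
    IsConj g (elt num3A) ∨ IsConj g (elt num3B) := by
  have h : sylowCheck 3 27 sylowGens3 sylowScript3 sylowConj3 [num3A, num3B] = true := by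
    decide +kernel
  have : Fact (Nat.Prime 3) := ⟨by norm_num⟩
  obtain ⟨n, hn, hc⟩ := isConj_of_sylowCheck (e := 3) h (by norm_num) (by norm_num) (by norm_num) hg
  simp only [List.mem_cons, List.not_mem_nil, or_false] at hn
  rcases hn with rfl | rfl
  exacts [Or.inl hc, Or.inr hc]

theorem isConj_of_orderOf_eq_five {g : Janko2} (hg : orderOf g = 5) :
    IsConj g (elt num5A) ∨ IsConj g (elt num5B) ∨ IsConj g (elt num5C) ∨ IsConj g (elt num5D) := by
  have h : sylowCheck 5 25 sylowGens5 sylowScript5 sylowConj5 [num5A, num5B, num5C, num5D] =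
      true := by
    decide +kernel
  have : Fact (Nat.Prime 5) := ⟨by norm_num⟩
  obtain ⟨n, hn, hc⟩ := isConj_of_sylowCheck (e := 2) h (by norm_num) (by norm_num) (by norm_num) hg
  simp only [List.mem_cons, List.not_mem_nil, or_false] at hn
  rcases hn with rfl | rfl | rfl | rfl
  exacts [Or.inl hc, Or.inr (Or.inl hc), Or.inr (Or.inr (Or.inl hc)), Or.inr (Or.inr (Or.inr hc))]

theorem isConj_of_orderOf_eq_seven {g : Janko2} (hg : orderOf g = 7) : IsConj g (elt num7A) := by
  have h : sylowCheck 7 7 sylowGens7 sylowScript7 sylowConj7 [num7A] = true := by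
    decide +kernel
  have : Fact (Nat.Prime 7) := ⟨by norm_num⟩
  obtain ⟨n, hn, hc⟩ := isConj_of_sylowCheck (e := 1) h (by norm_num) (by norm_num) (by norm_num) hg
  rwa [List.mem_singleton.mp hn] at hc

/-- The `p`-th power of the element number `n`, but not the element itself, is the identity. -/
noncomputable def orderCheck (p n : ℕ) : Bool :=
  withTables fun _ _ u v h => force (element u v h n) fun c => powIsOne p c && !(Nat.beq c onec)

theorem orderOf_of_powIsOne {p : ℕ} [Fact p.Prime] {g : Janko2} (h1 : powIsOne p (code g) = true)
    (h2 : Nat.beq (code g) onec = false) : orderOf g = p := by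
  rw [powIsOne_code] at h1
  rw [← Bool.not_eq_true, Nat.beq_eq, onec_eq] at h2
  refine orderOf_eq_prime (Subtype.ext h1) ?_
  rintro rfl
  exact h2 rfl

theorem orderOf_elt {p n : ℕ} [Fact p.Prime] (h : orderCheck p n = true) : orderOf (elt n) = p := by
  rw [orderCheck, withTables_eq, force_eq, ← code_elt, Bool.and_eq_true, Bool.not_eq_true'] at h
  exact orderOf_of_powIsOne h.1 h.2

/-- The element number `m` is the square of the element number `n`. -/
noncomputable def squareCheck (m n : ℕ) : Bool :=
  withTables fun _ _ u v h => force (element u v h n) fun c =>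
    Nat.beq (element u v h m) (mulc c c)

theorem elt_eq_sq {m n : ℕ} (h : squareCheck m n = true) : elt m = elt n ^ 2 := by
  rw [squareCheck, withTables_eq, force_eq, ← code_elt, ← code_elt, Nat.beq_eq, mulc_code] at h
  rw [pow_two]
  exact Subtype.ext (code_injective h)

/-! ## The action by conjugation -/

/-- Orbit-stabilizer for the conjugation action. -/
theorem card_carrier_mul_card_centralizer {G : Type*} [Group G] [Finite G] (x : G) :
    Nat.card (ConjClasses.mk x).carrier * Nat.card (Subgroup.centralizer ({x} : Set G)) =
      Nat.card G := by
  rw [Subgroup.nat_card_centralizer_nat_card_stabilizer, ← ConjAct.orbit_eq_carrier_conjClasses,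
    ← Nat.card_prod, Nat.card_congr (MulAction.orbitProdStabilizerEquivGroup (ConjAct G) x)]
  rfl

theorem card_centralizer_eq_of_isConj {G : Type*} [Group G] [Finite G] {x y : G} (h : IsConj x y) :
    Nat.card (Subgroup.centralizer ({x} : Set G)) =
      Nat.card (Subgroup.centralizer ({y} : Set G)) := by
  have hx := card_carrier_mul_card_centralizer x
  have hy := card_carrier_mul_card_centralizer y
  rw [ConjClasses.mk_eq_mk_iff_isConj.mpr h] at hx
  exact Nat.eq_of_mul_eq_mul_left
    (Nat.pos_of_mul_pos_right (b := Nat.card (Subgroup.centralizer ({y} : Set G))) (by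
      rw [hy]; exact Nat.card_pos)) (hx.trans hy.symm)

/-- Conjugation of permutations, on codes. -/
noncomputable def conjc (c d : ℕ) : ℕ :=
  force (invc c) fun i => ofDigitFun (fun n => digit c (digit d (digit i n))) 100

theorem conjc_code (σ τ : Equiv.Perm (Fin 100)) :
    conjc (code σ) (code τ) = code (σ * τ * σ⁻¹) := by
  rw [conjc, force_eq, invc_code]
  exact (code_eq_ofDigitFun fun i => by simp only [digit_code]; rfl).symm

/-- All values of a straight-line program of conjugations with generators of `J₂`. -/
noncomputable def conjugates (t : ℕ) (s : List ℕ) : List ℕ :=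
  slp (fun k x => conjc (nth onec gens0 k) x) t s [t]

theorem codesIn_conjugates (t : Janko2) (s : List ℕ) :
    CodesIn (fun σ => ∃ g : Janko2, IsConj t g ∧ σ = g) (conjugates (code t) s) := by
  have h1 : ∃ σ : Equiv.Perm (Fin 100), (∃ g : Janko2, IsConj t g ∧ σ = g) ∧ code σ = code t :=
    ⟨t, ⟨t, IsConj.refl t, rfl⟩, rfl⟩
  refine codesIn_slp ?_ h1 s fun c hc => ?_
  · rintro k _ ⟨g, hg, rfl⟩
    obtain ⟨σ, hσ, e⟩ := codesIn_gens0.nth ⟨1, Janko2.one_mem, onec_eq.symm⟩ k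
    refine ⟨σ * g * σ⁻¹, ⟨⟨σ, hσ⟩ * g * ⟨σ, hσ⟩⁻¹, ?_, rfl⟩, ?_⟩
    · exact hg.trans (isConj_iff.mpr ⟨⟨σ, hσ⟩, rfl⟩)
    · rw [← e, conjc_code]
  · rw [List.mem_singleton.mp hc]
    exact h1

/-- The program `s` lists the `m` conjugates of the element number `n`. For each conjugate `a`, with
`c` the element number `num7A` and `d = a⁻¹ * c`, the codes of `a`, `c`, `d` satisfy `f`, and if
`d ^ 5 = 1` then `d` is conjugate to the element number `num5C` or `num5D`, by an element numbered
by `conj`. -/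
noncomputable def classCheck (n m : ℕ) (s conj : List ℕ) (f : ℕ → ℕ → ℕ → Bool) : Bool :=
  withTables fun _ _ u v h => force (element u v h n) fun t => force (element u v h num7A) fun c =>
    force (element u v h num5C) fun y => force (element u v h num5D) fun z =>
    forceList (conj.map (element u v h)) fun r => forceList (conjugates t s) fun l =>
      allc gens0 (fun g => allc l fun x => force (conjc g x) (memc l)) && memc l t && nodupc l &&
      Nat.beq l.length m &&
      allc l fun a => force (mulc (invc a) c) fun d => f a c d && cond (powIsOne 5 d)
        (anyc r fun k => intertwines k d y || intertwines k d z) true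

/-- The list consists of conjugates, contains the representative and is closed under conjugation by
the generators, so it is the whole class. Being free of repetitions, its length is the class size,
which gives the centralizer order. Since `a * b = c` forces `b = a⁻¹ * c`, the test on quotients
sees every pair with product `c`. -/
theorem classCheck_spec {n m : ℕ} {s conj : List ℕ} {f : ℕ → ℕ → ℕ → Bool}
    (h : classCheck n m s conj f = true) :
    Nat.card (Subgroup.centralizer ({elt n} : Set Janko2)) * m = 604800 ∧
      ∀ a : Janko2, IsConj (elt n) a →
        f (code a) (code (elt num7A)) (code (a⁻¹ * elt num7A : Janko2)) = true ∧
        (orderOf (a⁻¹ * elt num7A) = 5 →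
          IsConj (a⁻¹ * elt num7A) (elt num5C) ∨ IsConj (a⁻¹ * elt num7A) (elt num5D)) := by
  rw [classCheck, withTables_eq] at h
  simp only [forceList_eq, force_eq, Bool.and_eq_true, allc_eq_true, memc_eq_true, nodupc_eq_true,
    Nat.beq_eq, ← code_elt] at h
  obtain ⟨⟨⟨⟨hclosed, hmem⟩, hnodup⟩, hlen⟩, hall⟩ := h
  set l := conjugates (code (elt n)) s with hl
  have hclass : ∀ a : Janko2, IsConj (elt n) a → code a ∈ l := by
    intro a ha
    obtain ⟨g, rfl⟩ := isConj_iff.mp ha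
    have hgen : ∀ x ∈ ({janko2GenA, janko2GenB} : Set (Equiv.Perm (Fin 100))),
        code x ∈ gens0 := by
      rintro x (rfl | rfl)
      · simp [code_janko2GenA, gens0]
      · simp [code_janko2GenB, gens0]
    obtain ⟨g, hg⟩ := g
    rw [Subgroup.coe_mul, Subgroup.coe_mul, Subgroup.coe_inv]
    have key : ∀ x ∈ ({janko2GenA, janko2GenB} : Set (Equiv.Perm (Fin 100))),
        ∀ y : Equiv.Perm (Fin 100), code y ∈ l → code (x * y * x⁻¹) ∈ l := by
      intro x hx y hy
      rw [← conjc_code]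
      exact hclosed _ (hgen x hx) _ hy
    -- The criterion with `K = ⊥`, applied to the set of elements that conjugate the representative
    -- into the list.
    obtain ⟨t, ht, h⟩ := exists_mem_inv_mul_mem
      (T := {g | code (g * elt n * g⁻¹) ∈ l}) (K := ⊥) (by simpa using hmem)
      (fun x hx y hy => ⟨x * y, by
        have := key x hx _ hy
        rw [Set.mem_ofPred_eq]
        convert this using 2
        group, by simp⟩) hg
    obtain rfl : t = g := by simpa [Subgroup.mem_bot, inv_mul_eq_one] using h
    exact ht
  refine ⟨?_, fun a ha => ?_⟩
  · rw [mul_comm, ← card_janko2, ← card_carrier_mul_card_centralizer (elt n)]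
    congr 1
    have hF : Function.Bijective (fun a => ⟨code a.1, List.mem_toFinset.mpr (hclass a.1 (by
        rw [← ConjClasses.mk_eq_mk_iff_isConj, eq_comm]
        exact ConjClasses.mem_carrier_iff_mk_eq.mp a.2))⟩ :
        (ConjClasses.mk (elt n)).carrier → l.toFinset) := by
      constructor
      · intro σ τ e
        have e' : code σ.1 = code τ.1 := by simpa only [Subtype.mk.injEq] using e
        exact Subtype.ext (Subtype.ext (code_injective e'))
      · rintro ⟨c, hc⟩
        obtain ⟨σ, ⟨g, hg, rfl⟩, rfl⟩ := codesIn_conjugates _ s c (List.mem_toFinset.mp hc)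
        exact ⟨⟨g, ConjClasses.mem_carrier_iff_mk_eq.mpr
          (ConjClasses.mk_eq_mk_iff_isConj.mpr hg.symm)⟩, rfl⟩
    rw [Nat.card_congr (Equiv.ofBijective _ hF), Nat.card_eq_fintype_card, Fintype.card_coe,
      List.toFinset_card_of_nodup hnodup, hlen]
  · have h := hall _ (hclass a ha)
    rw [invc_code, mulc_code, ← Subgroup.coe_inv, ← Subgroup.coe_mul] at h
    refine ⟨h.1, fun h5 => ?_⟩
    have hpow : powIsOne 5 (code (a⁻¹ * elt num7A : Janko2)) = true := by
      rw [powIsOne_code, ← Subgroup.coe_pow, ← h5, pow_orderOf_eq_one, Subgroup.coe_one]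
    have h2 := h.2
    rw [hpow, cond_true, anyc_eq_true] at h2
    obtain ⟨c, hc, h2⟩ := h2
    obtain ⟨r, hr, rfl⟩ := List.mem_map.mp hc
    rw [Bool.or_eq_true, ← code_elt, intertwines_code, intertwines_code] at h2
    refine h2.imp (fun h => ?_) fun h => ?_ <;>
    · refine isConj_iff.mpr ⟨elt r, ?_⟩
      rw [mul_inv_eq_iff_eq_mul]
      exact Subtype.ext h

/-! ## Pairs of generators -/

/-- With `a` the element number `m` and `b` the conjugate of the element number `n` by the inverse
of the element number `k`, the product `a * b` has order 7, and the words `s` and `t` in `a` and `b`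
yield the generators of `J₂`. -/
noncomputable def generationCheck (m n k : ℕ) (s t : List ℕ) : Bool :=
  withTables fun _ _ u v h => force (element u v h m) fun a => force (element u v h n) fun x =>
    force (element u v h k) fun g => force (conjc (invc g) x) fun b =>
      (force (mulc a b) fun c => powIsOne 7 c && !(Nat.beq c onec)) &&
      Nat.beq (wordc [a, b] s) genA && Nat.beq (wordc [a, b] t) genB

/-- The standard generators are words in `a` and `b`, so the subgroup generated by `a` and `b` is
everything. The comparison is made among all permutations, through the inclusion of J₂. -/
theorem exists_generators_of_check {m n k : ℕ} {s t : List ℕ}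
    (h : generationCheck m n k s t = true) : ∃ b : Janko2, IsConj (elt n) b ∧
      orderOf (elt m * b) = 7 ∧ Subgroup.closure {elt m, b} = ⊤ := by
  rw [generationCheck, withTables_eq] at h
  simp only [force_eq, ← code_elt, invc_code, conjc_code, Bool.and_eq_true, Bool.not_eq_true',
    Nat.beq_eq] at h
  rw [inv_inv, ← Subgroup.coe_inv, ← Subgroup.coe_mul, ← Subgroup.coe_mul, mulc_code,
    ← Subgroup.coe_mul] at h
  set b := (elt k)⁻¹ * elt n * elt k with hb
  obtain ⟨⟨⟨h7, h1⟩, hA⟩, hB⟩ := h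
  have : Fact (Nat.Prime 7) := ⟨by norm_num⟩
  refine ⟨b, isConj_iff.mpr ⟨(elt k)⁻¹, by rw [hb, inv_inv]⟩, orderOf_of_powIsOne h7 h1, ?_⟩
  have hmap : (Subgroup.closure {elt m, b}).map Janko2.subtype =
      Subgroup.closure {(elt m : Equiv.Perm (Fin 100)), (b : Equiv.Perm (Fin 100))} := by
    rw [MonoidHom.map_closure, Set.image_pair]
    rfl
  have hcodes : CodesIn (· ∈ (Subgroup.closure {elt m, b}).map Janko2.subtype)
      [code (elt m), code b] := by
    rw [hmap]
    intro c hc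
    simp only [List.mem_cons, List.not_mem_nil, or_false] at hc
    rcases hc with hc | hc
    · exact ⟨_, Subgroup.subset_closure (by simp), hc.symm⟩
    · exact ⟨_, Subgroup.subset_closure (by simp), hc.symm⟩
  have hle : Janko2 ≤ (Subgroup.closure {elt m, b}).map Janko2.subtype := by
    conv_lhs => rw [Janko2]
    rw [Subgroup.closure_le]
    rintro x (rfl | rfl)
    · obtain ⟨σ, hσ, e⟩ := exists_code_eq_wordc hcodes s
      rw [hA, ← code_janko2GenA] at e
      rwa [← code_injective e]
    · obtain ⟨σ, hσ, e⟩ := exists_code_eq_wordc hcodes t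
      rw [hB, ← code_janko2GenB] at e
      rwa [← code_injective e]
  rw [eq_top_iff]
  intro g _
  obtain ⟨g', hg', e⟩ := hle g.2
  rwa [← Subtype.ext e]

/-- Program for the conjugates of the element number `num2A`. -/
def classScript2A : List ℕ :=
  [1, 0, 5, 5, 4, 4, 9, 9, 9, 8, 8, 13, 12, 17, 17, 17, 4, 9, 8, 9, 8, 9, 8, 13, 13, 12, 8, 8,
   5, 5, 4, 9, 8, 13, 13, 12, 13, 12, 12, 17, 17, 16, 21, 21, 16, 16, 12, 12, 13, 13, 13, 13,
   12, 17, 16, 21, 20, 25, 24, 29, 29, 28, 29, 28, 29, 28, 29, 28, 28, 33, 33, 32, 37, 37, 36,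
   41, 41, 40, 45, 45, 45, 44, 44, 40, 40, 45, 45, 44, 44, 40, 40, 45, 45, 45, 45, 45, 45, 41,
   41, 41, 41, 41, 36, 36, 41, 40, 45, 44, 49, 48, 48, 48, 53, 52, 57, 56, 61, 60, 65, 65, 60,
   61, 60, 61, 60, 61, 57, 56, 57, 56, 57, 56, 57, 56, 56, 57, 56, 61, 61, 60, 65, 65, 64, 69,
   68, 73, 73, 72, 77, 77, 76, 81, 81, 80, 85, 85, 85, 84, 76, 81, 81, 80, 72, 73, 68, 64, 64,
   69, 69, 68, 68, 64, 65, 64, 69, 69, 69, 65, 65, 65, 65, 61, 61, 57, 57, 57, 57, 56, 48, 53,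
   53, 52, 52, 57, 57, 56, 56, 61, 60, 65, 64, 64, 69, 68, 73, 72, 73, 73, 68, 69, 69, 61, 61,
   60, 61, 60, 61, 61, 60, 61, 60, 61, 60, 61, 61, 60, 65, 64, 69, 68, 73, 72, 77, 77, 76, 81,
   81, 80, 85, 84, 89, 89, 88, 93, 93, 92, 97, 97, 96, 96, 101, 101, 100, 101, 100, 101, 100,
   101, 96, 92, 92, 97, 97, 96, 97, 96, 96, 92, 93, 93, 88, 93, 93, 93, 92, 81, 80, 85, 85, 85,
   77, 76, 65, 65, 65, 61, 56, 56, 61, 60, 65, 61, 56, 52, 52, 57, 53, 52, 48, 49, 49, 48, 37,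
   33, 28, 29, 24, 16, 16, 21, 21, 20, 17, 1]

/-- Numbers of elements conjugating the quotients `a⁻¹ * c` of order 5 to representatives, for `a`
in the class `2A` and `c` the element number `num7A`. -/
def classConj2A : List ℕ :=
  [99365, 214199, 272746, 320369, 329654, 334074, 347156, 373549, 430323, 458243, 466418,
   518566, 552426, 599881]

/-- Program for the conjugates of the element number `num3A`. -/
def classScript3A : List ℕ :=
  [0, 5, 5, 4, 9, 8, 13, 13, 12, 13, 12, 12, 17, 17, 16, 21, 21, 21, 20, 20, 25, 25, 24, 24, 29,
   28, 33, 33, 33, 32, 33, 33, 33, 32, 33, 32, 33, 32, 37, 37, 36, 36, 41, 40, 45, 45, 44, 49,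
   49, 48, 49, 48, 45, 45, 44, 45, 44, 44, 40, 40, 45, 41, 41, 40, 45, 44, 49, 49, 48, 53, 49,
   49, 49, 48, 48, 48, 53, 48, 49, 48, 48, 41, 40, 45, 44, 49, 49, 49, 49, 48, 49, 48, 53, 53,
   53, 52, 53, 52, 53, 52, 52, 52, 57, 56, 61, 61, 60, 56, 56, 61, 60, 65, 65, 64, 69, 69, 68,
   73, 73, 73, 68, 69, 68, 68, 61, 60, 61, 60, 60, 65, 65, 64, 64, 60, 60, 65, 64, 65, 64, 69,
   69, 69, 68, 73, 73, 72, 77, 77, 77, 73, 73, 73, 73, 73, 72, 73, 72, 68, 68, 73, 72, 77, 77,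
   76, 76, 72, 72, 77, 77, 76, 76, 81, 80, 85, 84, 89, 88, 93, 93, 92, 97, 97, 97, 97, 96, 97,
   96, 97, 97, 97, 97, 97, 92, 93, 93, 92, 93, 92, 93, 92, 93, 92, 92, 84, 89, 88, 93, 92, 97,
   97, 96, 101, 101, 100, 100, 105, 104, 109, 108, 113, 112, 117, 117, 116, 121, 120, 125, 125,
   124, 129, 129, 128, 133, 133, 132, 137, 137, 137, 137, 136, 137, 136, 137, 136, 136, 132,
   132, 137, 137, 137, 136, 137, 136, 137, 136, 137, 136, 136, 141, 141, 140, 141, 140, 140,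
   136, 136, 141, 141, 140, 140, 136, 136, 141, 140, 145, 145, 145, 144, 149, 149, 148, 153,
   149, 149, 149, 144, 149, 148, 153, 145, 144, 149, 141, 141, 140, 140, 145, 145, 144, 149,
   149, 149, 149, 149, 145, 145, 145, 145, 145, 144, 145, 144, 144, 144, 149, 149, 148, 148,
   141, 141, 140, 145, 145, 144, 145, 144, 144, 149, 149, 148, 148, 153, 152, 157, 157, 140,
   140, 145, 144, 149, 148, 153, 152, 157, 156, 156, 161, 160, 165, 164, 169, 168, 173, 173,
   172, 177, 177, 177, 169, 169, 169, 164, 165, 160, 165, 165, 164, 169, 169, 169, 165, 165,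
   165, 164, 160, 160, 161, 161, 160, 161, 160, 161, 160, 161, 160, 161, 161, 160, 161, 160,
   161, 160, 161, 160, 160, 149, 144, 149, 149, 149, 148, 153, 148, 148, 144, 144, 149, 148,
   153, 152, 149, 149, 149, 149, 149, 148, 153, 153, 152, 157, 157, 156, 161, 153, 152, 157,
   156, 161, 153, 152, 157, 157, 156, 161, 157, 129, 129, 129, 129, 117, 116, 112, 117, 116,
   121, 120, 121, 116, 108, 113, 113, 112, 113, 113, 112, 113, 108, 113, 113, 112, 100, 100,
   105, 104, 109, 108, 109, 108, 113, 113, 113, 112, 113, 112, 113, 112, 117, 105, 105, 104,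
   104, 109, 109, 108, 109, 105, 105, 105, 100, 101, 100, 101, 100, 92, 92, 97, 97, 96, 101, 88,
   84, 89, 80, 80, 77, 72, 72, 73, 72, 77, 77, 76, 73, 68, 60, 61, 61, 57, 57, 44, 36, 41, 41,
   40, 41, 41, 40, 41, 40, 45, 44, 49, 49, 32, 32, 37, 32, 33, 32, 33, 32, 32, 37, 33, 29, 29,
   29, 28, 33, 33, 25, 24, 29, 24, 20, 16, 17, 9, 5]

/-- Numbers of elements conjugating the quotients `a⁻¹ * c` of order 5 to representatives, for `a`
in the class `3A` and `c` the element number `num7A`. -/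
def classConj3A : List ℕ :=
  [17119, 33792, 49066, 49854, 63132, 86617, 114676, 191961, 196046, 203796, 207040, 218890,
   245338, 249158, 319497, 348735, 352130, 379672, 450175, 522792, 532476, 591086, 601457,
   601498, 602833, 603132, 604188, 604635]

/-! ### Quotients of the fixed element of order 7, and explicit generating pairs -/

theorem classCheck_2A : classCheck num2A 315 classScript2A classConj2A
    (fun a c d => cond (powIsOne 3 d) (Nat.beq (digit c 44) 44 && Nat.beq (digit a 44) 44) true) =
      true := by
  decide +kernel

theorem classCheck_3A : classCheck num3A 560 classScript3A classConj3A
    (fun _ _ d => !(powIsOne 2 d)) = true := by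
  decide +kernel

theorem exists_generators_2B_3B : ∃ b : Janko2, IsConj (elt num3B) b ∧
    orderOf (elt num2B * b) = 7 ∧ Subgroup.closure {elt num2B, b} = ⊤ :=
  exists_generators_of_check (k := 388039)
    (s := [1, 0, 1, 0, 1, 1, 0, 1, 0, 1, 1, 0, 1, 1, 0, 1, 0, 1, 0, 1, 1, 0, 1, 1, 0, 1, 0, 1,
      0, 1, 1, 0, 1, 0, 1, 0, 1, 1, 0, 1, 1, 0, 1, 0, 1, 0, 1, 1, 0, 1, 0, 1, 1, 0, 1, 0, 1,
      0, 1, 1, 0, 1, 1, 0, 1, 0])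
    (t := [1, 0, 1, 0, 1, 1, 0, 1, 0, 1, 0, 1, 1, 0, 1, 1, 0, 1, 0, 1, 0, 1, 0])
    (by decide +kernel)

theorem exists_generators_2A_5C : ∃ b : Janko2, IsConj (elt num5C) b ∧
    orderOf (elt num2A * b) = 7 ∧ Subgroup.closure {elt num2A, b} = ⊤ :=
  exists_generators_of_check (k := 126607)
    (s := [0, 1, 0, 1, 0, 1, 1, 1, 1, 0, 1, 1, 0, 1, 0, 1, 1, 0, 1, 0, 1, 0, 1, 0, 1, 1, 0, 1,
      1])
    (t := [1, 1, 0, 1, 1, 0, 1, 1, 1, 1, 0, 1, 1, 1, 0, 1, 0, 1, 0, 1, 1, 1, 0, 1, 1, 0, 1, 0,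
      1])
    (by decide +kernel)

theorem exists_generators_2A_5D : ∃ b : Janko2, IsConj (elt num5D) b ∧
    orderOf (elt num2A * b) = 7 ∧ Subgroup.closure {elt num2A, b} = ⊤ :=
  exists_generators_of_check (k := 419206)
    (s := [1, 0, 1, 1, 0, 1, 1, 1, 0, 1, 0, 1, 0, 1, 1, 1, 0, 1, 1, 1, 1, 0, 1, 1, 0, 1, 0, 1,
      1, 1, 0, 1, 1, 1, 0, 1])
    (t := [0, 1, 0, 1, 1, 1, 0, 1, 0, 1, 0, 1, 1, 1, 1, 0, 1, 1, 1, 0, 1, 0])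
    (by decide +kernel)

theorem exists_generators_2B_5A : ∃ b : Janko2, IsConj (elt num5A) b ∧
    orderOf (elt num2B * b) = 7 ∧ Subgroup.closure {elt num2B, b} = ⊤ :=
  exists_generators_of_check (k := 437637)
    (s := [1, 1, 1, 1, 0, 1, 0, 1, 1, 0, 1, 0, 1, 0, 1, 0, 1, 1])
    (t := [0, 1, 1, 1, 0, 1, 1, 0, 1, 1, 0, 1, 1, 1, 1, 0, 1, 0, 1, 1, 0, 1, 0, 1, 1, 1, 0])
    (by decide +kernel)

theorem exists_generators_2B_5B : ∃ b : Janko2, IsConj (elt num5B) b ∧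
    orderOf (elt num2B * b) = 7 ∧ Subgroup.closure {elt num2B, b} = ⊤ :=
  exists_generators_of_check (k := 544950)
    (s := [1, 0, 1, 1, 1, 1, 0, 1, 1, 0, 1, 1, 1, 0, 1, 0, 1, 1, 1, 1])
    (t := [1, 0, 1, 0, 1, 0, 1, 1, 0, 1, 0, 1, 1, 1, 0, 1, 0, 1, 1, 1, 1, 0, 1, 0, 1, 1, 1, 0,
      1, 1])
    (by decide +kernel)

theorem exists_generators_2B_5C : ∃ b : Janko2, IsConj (elt num5C) b ∧
    orderOf (elt num2B * b) = 7 ∧ Subgroup.closure {elt num2B, b} = ⊤ :=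
  exists_generators_of_check (k := 382630)
    (s := [0, 1, 0, 1, 1, 0, 1, 1, 0, 1, 1, 0, 1, 1, 1, 1, 0, 1, 1, 0, 1, 1, 1, 0, 1, 1])
    (t := [0, 1, 0, 1, 0, 1, 1, 1, 0, 1, 0, 1, 1, 1, 0, 1, 0, 1, 1, 1, 0, 1, 1])
    (by decide +kernel)

theorem exists_generators_2B_5D : ∃ b : Janko2, IsConj (elt num5D) b ∧
    orderOf (elt num2B * b) = 7 ∧ Subgroup.closure {elt num2B, b} = ⊤ :=
  exists_generators_of_check (k := 6934)
    (s := [1, 0, 1, 0, 1, 1, 0, 1, 1, 1, 0, 1, 1, 1, 1, 0, 1, 1, 1, 1])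
    (t := [1, 0, 1, 0, 1, 1, 0, 1, 0, 1, 1, 1, 0, 1, 1, 0, 1, 1, 1, 1, 0, 1, 1, 0, 1, 1, 0, 1,
      1, 1, 1])
    (by decide +kernel)

theorem exists_generators_3A_5C : ∃ b : Janko2, IsConj (elt num5C) b ∧
    orderOf (elt num3A * b) = 7 ∧ Subgroup.closure {elt num3A, b} = ⊤ :=
  exists_generators_of_check (k := 289158)
    (s := [0, 1, 1, 0, 1, 1, 0, 1, 0, 1, 1, 1, 0, 0, 1, 0, 1, 0, 1, 0, 1, 0, 1, 1])
    (t := [0, 0, 1, 0, 0, 1, 1, 0, 1, 1, 0, 1, 1, 1, 1, 0, 0])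
    (by decide +kernel)

theorem exists_generators_3A_5D : ∃ b : Janko2, IsConj (elt num5D) b ∧
    orderOf (elt num3A * b) = 7 ∧ Subgroup.closure {elt num3A, b} = ⊤ :=
  exists_generators_of_check (k := 521312)
    (s := [0, 1, 0, 1, 1, 1, 0, 1, 1, 0, 1, 0, 1, 0, 0, 1, 1, 1, 0, 0, 1, 1, 1])
    (t := [0, 0, 1, 1, 1, 0, 0, 1, 0, 0, 1, 1, 0, 1, 0, 1, 0, 1, 1])
    (by decide +kernel)

theorem exists_generators_3B_5A : ∃ b : Janko2, IsConj (elt num5A) b ∧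
    orderOf (elt num3B * b) = 7 ∧ Subgroup.closure {elt num3B, b} = ⊤ :=
  exists_generators_of_check (k := 443902)
    (s := [0, 0, 1, 0, 1, 0, 0, 1, 1, 1, 1, 0, 1, 0])
    (t := [0, 0, 1, 1, 1, 0, 1, 0, 1, 0, 0, 1, 1, 0, 0, 1, 1, 1, 0, 1, 1, 1])
    (by decide +kernel)

theorem exists_generators_3B_5B : ∃ b : Janko2, IsConj (elt num5B) b ∧
    orderOf (elt num3B * b) = 7 ∧ Subgroup.closure {elt num3B, b} = ⊤ :=
  exists_generators_of_check (k := 199134)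
    (s := [0, 0, 1, 1, 0, 1, 1, 0, 0, 1, 1, 1, 0, 1, 1, 0])
    (t := [1, 1, 1, 1, 0, 1, 0, 1, 1, 1, 0, 0, 1, 0, 1, 0, 1, 1, 1])
    (by decide +kernel)

theorem exists_generators_3B_5C : ∃ b : Janko2, IsConj (elt num5C) b ∧
    orderOf (elt num3B * b) = 7 ∧ Subgroup.closure {elt num3B, b} = ⊤ :=
  exists_generators_of_check (k := 356806)
    (s := [1, 0, 1, 1, 0, 1, 0, 1, 0, 1, 1, 1, 1, 0, 1, 0, 0, 1, 1])
    (t := [1, 0, 1, 1, 0, 0, 1, 1, 0, 1, 1, 1, 0, 1, 1, 0, 0, 1, 0, 1, 1, 1, 1, 0])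
    (by decide +kernel)

theorem exists_generators_3B_5D : ∃ b : Janko2, IsConj (elt num5D) b ∧
    orderOf (elt num3B * b) = 7 ∧ Subgroup.closure {elt num3B, b} = ⊤ :=
  exists_generators_of_check (k := 370450)
    (s := [0, 1, 1, 0, 1, 0, 1, 1, 1, 1, 0, 0, 1, 0, 1, 1, 1, 0, 1, 1])
    (t := [1, 1, 1, 0, 0, 1, 1, 0, 0, 1, 0, 0, 1, 0, 1, 0, 0, 1, 1, 1])
    (by decide +kernel)


/-! ## Orders and centralizers of the representatives -/

theorem orderOf_2A : orderOf (elt num2A) = 2 :=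
  have : Fact (Nat.Prime 2) := ⟨by norm_num⟩
  orderOf_elt (by decide +kernel)

theorem orderOf_2B : orderOf (elt num2B) = 2 :=
  have : Fact (Nat.Prime 2) := ⟨by norm_num⟩
  orderOf_elt (by decide +kernel)

theorem orderOf_3A : orderOf (elt num3A) = 3 :=
  have : Fact (Nat.Prime 3) := ⟨by norm_num⟩
  orderOf_elt (by decide +kernel)

theorem orderOf_3B : orderOf (elt num3B) = 3 :=
  have : Fact (Nat.Prime 3) := ⟨by norm_num⟩
  orderOf_elt (by decide +kernel)

theorem orderOf_5A : orderOf (elt num5A) = 5 :=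
  have : Fact (Nat.Prime 5) := ⟨by norm_num⟩
  orderOf_elt (by decide +kernel)

theorem orderOf_5C : orderOf (elt num5C) = 5 :=
  have : Fact (Nat.Prime 5) := ⟨by norm_num⟩
  orderOf_elt (by decide +kernel)

theorem orderOf_7A : orderOf (elt num7A) = 7 :=
  have : Fact (Nat.Prime 7) := ⟨by norm_num⟩
  orderOf_elt (by decide +kernel)

theorem card_centralizer_2A :
    Nat.card (Subgroup.centralizer ({elt num2A} : Set Janko2)) = 1920 := by
  have h := (classCheck_spec classCheck_2A).1
  exact Nat.eq_of_mul_eq_mul_right (by norm_num : 0 < 315) (h.trans (by norm_num))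

theorem card_centralizer_3A :
    Nat.card (Subgroup.centralizer ({elt num3A} : Set Janko2)) = 1080 := by
  have h := (classCheck_spec classCheck_3A).1
  exact Nat.eq_of_mul_eq_mul_right (by norm_num : 0 < 560) (h.trans (by norm_num))

/-- `x` and `x ^ 2` are powers of each other, as `x = (x ^ 2) ^ 3`. The representatives of 5B and 5D
are squares of those of 5A and 5C, which spares two centralizer counts. -/
theorem centralizer_sq_of_pow_five {G : Type*} [Group G] {x : G} (hx : orderOf x = 5) :
    Subgroup.centralizer ({x ^ 2} : Set G) = Subgroup.centralizer {x} := by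
  have h5 : x ^ 5 = 1 := by rw [← hx, pow_orderOf_eq_one]
  have h6 : (x ^ 2) ^ 3 = x := by rw [← pow_mul, show 2 * 3 = 5 + 1 from rfl, pow_add, h5]; simp
  ext g
  rw [Subgroup.mem_centralizer_singleton_iff, Subgroup.mem_centralizer_singleton_iff]
  constructor
  · intro h
    have : Commute g ((x ^ 2) ^ 3) := Commute.pow_right h 3
    rwa [h6] at this
  · intro h
    exact Commute.pow_right (show Commute g x from h) 2

theorem card_centralizer_5B :
    Nat.card (Subgroup.centralizer ({elt num5B} : Set Janko2)) = 300 := by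
  rw [elt_eq_sq (m := num5B) (n := num5A) (by decide +kernel),
    centralizer_sq_of_pow_five orderOf_5A, card_centralizer_5A]

theorem card_centralizer_5D :
    Nat.card (Subgroup.centralizer ({elt num5D} : Set Janko2)) = 50 := by
  rw [elt_eq_sq (m := num5D) (n := num5C) (by decide +kernel),
    centralizer_sq_of_pow_five orderOf_5C, card_centralizer_5C]

/-! ## Identification of the classes -/

theorem hasOrderAndCentralizer_mk {n k : ℕ} {x : Janko2} (h1 : orderOf x = n)
    (h2 : Nat.card (Subgroup.centralizer ({x} : Set Janko2)) = k) :
    HasOrderAndCentralizer n k (ConjClasses.mk x) := by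
  intro y hy
  have h : IsConj y x :=
    ConjClasses.mk_eq_mk_iff_isConj.mp (ConjClasses.mem_carrier_iff_mk_eq.mp hy)
  exact ⟨(orderOf_eq_of_isConj h).trans h1, (card_centralizer_eq_of_isConj h).trans h2⟩

theorem eq_mk_of_isConj {G : Type*} [Group G] {x y : G} (h : IsConj x y) :
    ConjClasses.mk x = ConjClasses.mk y :=
  ConjClasses.mk_eq_mk_iff_isConj.mpr h

/-- Fusion leaves two candidates, and the centralizer order excludes one. -/
theorem eq_mk_2A {C : ConjClasses Janko2} (h : HasOrderAndCentralizer 2 1920 C) :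
    C = ConjClasses.mk (elt num2A) := by
  obtain ⟨x, rfl⟩ := C.exists_rep
  obtain ⟨h1, h2⟩ := h x ConjClasses.mem_carrier_mk
  rcases isConj_of_orderOf_eq_two h1 with h | h
  · exact eq_mk_of_isConj h
  · rw [card_centralizer_eq_of_isConj h, card_centralizer_2B] at h2
    omega

theorem eq_mk_2B {C : ConjClasses Janko2} (h : HasOrderAndCentralizer 2 240 C) :
    C = ConjClasses.mk (elt num2B) := by
  obtain ⟨x, rfl⟩ := C.exists_rep
  obtain ⟨h1, h2⟩ := h x ConjClasses.mem_carrier_mk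
  rcases isConj_of_orderOf_eq_two h1 with h | h
  · rw [card_centralizer_eq_of_isConj h, card_centralizer_2A] at h2
    omega
  · exact eq_mk_of_isConj h

theorem eq_mk_3A {C : ConjClasses Janko2} (h : HasOrderAndCentralizer 3 1080 C) :
    C = ConjClasses.mk (elt num3A) := by
  obtain ⟨x, rfl⟩ := C.exists_rep
  obtain ⟨h1, h2⟩ := h x ConjClasses.mem_carrier_mk
  rcases isConj_of_orderOf_eq_three h1 with h | h
  · exact eq_mk_of_isConj h
  · rw [card_centralizer_eq_of_isConj h, card_centralizer_3B] at h2
    omega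

theorem eq_mk_3B {C : ConjClasses Janko2} (h : HasOrderAndCentralizer 3 36 C) :
    C = ConjClasses.mk (elt num3B) := by
  obtain ⟨x, rfl⟩ := C.exists_rep
  obtain ⟨h1, h2⟩ := h x ConjClasses.mem_carrier_mk
  rcases isConj_of_orderOf_eq_three h1 with h | h
  · rw [card_centralizer_eq_of_isConj h, card_centralizer_3A] at h2
    omega
  · exact eq_mk_of_isConj h

/-- The centralizer order excludes 5C and 5D but cannot separate 5A from 5B. -/
theorem eq_mk_5A {C : ConjClasses Janko2} (h : HasOrderAndCentralizer 5 300 C) :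
    C = ConjClasses.mk (elt num5A) ∨ C = ConjClasses.mk (elt num5B) := by
  obtain ⟨x, rfl⟩ := C.exists_rep
  obtain ⟨h1, h2⟩ := h x ConjClasses.mem_carrier_mk
  rcases isConj_of_orderOf_eq_five h1 with h | h | h | h
  · exact Or.inl (eq_mk_of_isConj h)
  · exact Or.inr (eq_mk_of_isConj h)
  · rw [card_centralizer_eq_of_isConj h, card_centralizer_5C] at h2
    omega
  · rw [card_centralizer_eq_of_isConj h, card_centralizer_5D] at h2
    omega

theorem eq_mk_5C {C : ConjClasses Janko2} (h : HasOrderAndCentralizer 5 50 C) :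
    C = ConjClasses.mk (elt num5C) ∨ C = ConjClasses.mk (elt num5D) := by
  obtain ⟨x, rfl⟩ := C.exists_rep
  obtain ⟨h1, h2⟩ := h x ConjClasses.mem_carrier_mk
  rcases isConj_of_orderOf_eq_five h1 with h | h | h | h
  · rw [card_centralizer_eq_of_isConj h, card_centralizer_5A] at h2
    omega
  · rw [card_centralizer_eq_of_isConj h, card_centralizer_5B] at h2
    omega
  · exact Or.inl (eq_mk_of_isConj h)
  · exact Or.inr (eq_mk_of_isConj h)

theorem mem_carrier_7A {C : ConjClasses Janko2} {k : ℕ} (h : HasOrderAndCentralizer 7 k C)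
    {x : Janko2} (hx : orderOf x = 7) : x ∈ C.carrier := by
  obtain ⟨y, rfl⟩ := C.exists_rep
  have hy := isConj_of_orderOf_eq_seven (h y ConjClasses.mem_carrier_mk).1
  exact ConjClasses.mem_carrier_iff_mk_eq.mpr
    (eq_mk_of_isConj ((isConj_of_orderOf_eq_seven hx).trans hy.symm))

/-! ## Generation -/

theorem isClassGenerated_of_closure_eq_top {G : Type*} [Group G] [Finite G]
    {C₁ C₂ C₃ : ConjClasses G} {a b : G} (ha : a ∈ C₁.carrier) (hb : b ∈ C₂.carrier)
    (hab : a * b ∈ C₃.carrier) (h : Subgroup.closure {a, b} = ⊤) : IsClassGenerated C₁ C₂ C₃ := by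
  refine ⟨a * b, hab, ?_⟩
  rw [xiStar, Nat.card_pos_iff]
  exact ⟨⟨⟨(a, b), ha, hb, rfl, h⟩⟩, inferInstance⟩

/-- Conjugating a generating pair conjugates its product, so the product may be any prescribed
element of the third class. -/
theorem IsClassGenerated.exists_pair {G : Type*} [Group G] [Finite G] {C₁ C₂ C₃ : ConjClasses G}
    (h : IsClassGenerated C₁ C₂ C₃) {c : G} (hc : c ∈ C₃.carrier) :
    ∃ a ∈ C₁.carrier, ∃ b ∈ C₂.carrier, a * b = c ∧ Subgroup.closure {a, b} = ⊤ := by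
  obtain ⟨c', hc', h⟩ := h
  rw [xiStar, Nat.card_pos_iff] at h
  obtain ⟨⟨⟨⟨a, b⟩, ha, hb, hab, htop⟩⟩, -⟩ := h
  simp only at ha hb hab htop
  obtain ⟨g, rfl⟩ : ∃ g, g * c' * g⁻¹ = c := isConj_iff.mp (ConjClasses.mk_eq_mk_iff_isConj.mp
    ((ConjClasses.mem_carrier_iff_mk_eq.mp hc').trans (ConjClasses.mem_carrier_iff_mk_eq.mp hc).symm))
  have hcarrier : ∀ {C : ConjClasses G} {x : G}, x ∈ C.carrier → g * x * g⁻¹ ∈ C.carrier := by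
    intro C x hx
    rw [ConjClasses.mem_carrier_iff_mk_eq] at hx ⊢
    rw [← hx]
    exact (eq_mk_of_isConj (isConj_iff.mpr ⟨g, rfl⟩)).symm
  refine ⟨_, hcarrier ha, _, hcarrier hb, by rw [← hab]; group, ?_⟩
  have h := congrArg (Subgroup.map (MulAut.conj g).toMonoidHom) htop
  rw [MonoidHom.map_closure, Set.image_pair,
    Subgroup.map_top_of_surjective _ (MulAut.conj g).surjective] at h
  exact h

theorem isClassGenerated_of_exists {n m : ℕ} {C : ConjClasses Janko2} {k : ℕ}
    (hC : HasOrderAndCentralizer 7 k C) (h : ∃ b : Janko2, IsConj (elt n) b ∧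
      orderOf (elt m * b) = 7 ∧ Subgroup.closure {elt m, b} = ⊤) :
    IsClassGenerated (ConjClasses.mk (elt m)) (ConjClasses.mk (elt n)) C := by
  obtain ⟨b, hb, h7, htop⟩ := h
  exact isClassGenerated_of_closure_eq_top ConjClasses.mem_carrier_mk
    (ConjClasses.mem_carrier_iff_mk_eq.mpr (eq_mk_of_isConj hb.symm)) (mem_carrier_7A hC h7) htop

/-! ## Non-generation -/

/-- The pair lies in the stabilizer of 44, which is proper because `janko2GenA` moves 44. -/
theorem closure_ne_top_of_fixes {a b : Janko2} (ha : digit (code a) 44 = 44)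
    (hb : digit (code b) 44 = 44) : Subgroup.closure {a, b} ≠ ⊤ := by
  intro h
  have hfix : ∀ g : Janko2, digit (code g) 44 = 44 → (g : Equiv.Perm (Fin 100)) 44 = 44 := by
    intro g hg
    have h := digit_code g 44
    rw [show ((44 : Fin 100) : ℕ) = 44 from rfl, hg] at h
    exact Fin.ext h.symm
  have hle : Subgroup.closure {a, b} ≤
      (MulAction.stabilizer (Equiv.Perm (Fin 100)) (44 : Fin 100)).comap Janko2.subtype := by
    rw [Subgroup.closure_le]
    rintro x (rfl | rfl)
    · exact hfix _ ha
    · exact hfix _ hb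
  rw [h] at hle
  have hall : ∀ x : Janko2, (x : Equiv.Perm (Fin 100)) 44 = 44 :=
    fun x => hle (Subgroup.mem_top x)
  obtain ⟨x, hx⟩ : ∃ x : Janko2, (x : Equiv.Perm (Fin 100)) = janko2GenA :=
    ⟨⟨_, genA_mem⟩, rfl⟩
  have h1 := hall x
  rw [hx] at h1
  have h2 := digit_code janko2GenA 44
  rw [h1, code_janko2GenA] at h2
  revert h2
  decide

/-- Only the order of the second factor enters, so 3A and 3B are treated together. -/
theorem not_isClassGenerated_2A_of_order_three {C D : ConjClasses Janko2} {k l : ℕ}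
    (hC : HasOrderAndCentralizer 3 k C) (hD : HasOrderAndCentralizer 7 l D) :
    ¬ IsClassGenerated (ConjClasses.mk (elt num2A)) C D := by
  intro h
  obtain ⟨a, ha, b, hb, hab, htop⟩ := h.exists_pair (mem_carrier_7A hD orderOf_7A)
  have hconj : IsConj (elt num2A) a :=
    (ConjClasses.mk_eq_mk_iff_isConj.mp (ConjClasses.mem_carrier_iff_mk_eq.mp ha)).symm
  obtain ⟨hf, -⟩ := (classCheck_spec classCheck_2A).2 a hconj
  have hb' : a⁻¹ * elt num7A = b := by rw [← hab, inv_mul_cancel_left]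
  have hpow : powIsOne 3 (code b) = true := by
    rw [powIsOne_code, ← Subgroup.coe_pow, ← (hC b hb).1, pow_orderOf_eq_one, Subgroup.coe_one]
  rw [hb', hpow, cond_true, Bool.and_eq_true, Nat.beq_eq, Nat.beq_eq] at hf
  -- Both `a` and `a * b` fix 44, so `a` sends `b 44` and 44 to the same point.
  have hfix : digit (code b) 44 = 44 := by
    have e := digit_mulc_code a b 44
    rw [mulc_code, ← Subgroup.coe_mul, hab] at e
    have e' : (44 : ℕ) = digit (code a) (digit (code b) 44) := hf.1.symm.trans e
    have hlt := digit_code_lt b (n := 44) (by norm_num)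
    have h1 := digit_code a ⟨_, hlt⟩
    have h2 := digit_code a 44
    have h3 : (a : Equiv.Perm (Fin 100)) 44 = 44 := Fin.ext (h2.symm.trans hf.2)
    have h4 : (a : Equiv.Perm (Fin 100)) ⟨_, hlt⟩ = 44 := Fin.ext (h1.symm.trans e'.symm)
    have h5 := (a : Equiv.Perm (Fin 100)).injective (h4.trans h3.symm)
    exact congrArg Fin.val h5
  exact closure_ne_top_of_fixes hf.2 hfix htop

/-- The search runs over the second factor, in the class 3A: if `a * b = c`, then `b⁻¹ * c` is
conjugate to `a`, an involution, and this never occurs. -/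
theorem not_isClassGenerated_2B_3A {D : ConjClasses Janko2} {l : ℕ}
    (hD : HasOrderAndCentralizer 7 l D) :
    ¬ IsClassGenerated (ConjClasses.mk (elt num2B)) (ConjClasses.mk (elt num3A)) D := by
  intro h
  obtain ⟨a, ha, b, hb, hab, -⟩ := h.exists_pair (mem_carrier_7A hD orderOf_7A)
  have hconj : IsConj (elt num3A) b :=
    (ConjClasses.mk_eq_mk_iff_isConj.mp (ConjClasses.mem_carrier_iff_mk_eq.mp hb)).symm
  obtain ⟨hf, -⟩ := (classCheck_spec classCheck_3A).2 b hconj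
  have ha2 : a ^ 2 = 1 := by
    rw [← (hasOrderAndCentralizer_mk orderOf_2B card_centralizer_2B a ha).1, pow_orderOf_eq_one]
  have hpow : powIsOne 2 (code (b⁻¹ * elt num7A : Janko2)) = true := by
    rw [powIsOne_code, ← Subgroup.coe_pow, ← hab]
    have : (b⁻¹ * (a * b)) ^ 2 = 1 := by
      rw [pow_two, show b⁻¹ * (a * b) * (b⁻¹ * (a * b)) = b⁻¹ * (a * a) * b by group, ← pow_two, ha2]
      group
    rw [this, Subgroup.coe_one]
  rw [hpow] at hf
  exact absurd hf (by simp)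

/-- No pair with product of order 7 exists at all: the second factor would be conjugate to a
representative of 5C or 5D, with centralizer of order 50. -/
theorem not_isClassGenerated_of_classCheck {n m k l : ℕ} {s conj : List ℕ}
    {f : ℕ → ℕ → ℕ → Bool} (h : classCheck n m s conj f = true) {C D : ConjClasses Janko2}
    (hC : HasOrderAndCentralizer 5 k C) (hk : k ≠ 50) (hD : HasOrderAndCentralizer 7 l D) :
    ¬ IsClassGenerated (ConjClasses.mk (elt n)) C D := by
  intro hgen
  obtain ⟨a, ha, b, hb, hab, -⟩ := hgen.exists_pair (mem_carrier_7A hD orderOf_7A)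
  have hconj : IsConj (elt n) a :=
    (ConjClasses.mk_eq_mk_iff_isConj.mp (ConjClasses.mem_carrier_iff_mk_eq.mp ha)).symm
  obtain ⟨-, hf⟩ := (classCheck_spec h).2 a hconj
  have hb' : a⁻¹ * elt num7A = b := by rw [← hab, inv_mul_cancel_left]
  rw [hb'] at hf
  obtain ⟨h5, hcard⟩ := hC b hb
  rcases hf h5 with h | h
  · rw [card_centralizer_eq_of_isConj h, card_centralizer_5C] at hcard
    exact hk hcard.symm
  · rw [card_centralizer_eq_of_isConj h, card_centralizer_5D] at hcard
    exact hk hcard.symm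

theorem theoremC :
    Nonempty Janko2AtlasClasses ∧
    ∀ K : Janko2AtlasClasses,
      (IsClassGenerated K.cl2B K.cl3B K.cl7A ∧
        IsClassGenerated K.cl2A K.cl5C K.cl7A ∧
        IsClassGenerated K.cl2B K.cl5A K.cl7A ∧
        IsClassGenerated K.cl2B K.cl5C K.cl7A ∧
        IsClassGenerated K.cl3A K.cl5C K.cl7A ∧
        IsClassGenerated K.cl3B K.cl5A K.cl7A ∧
        IsClassGenerated K.cl3B K.cl5C K.cl7A) ∧
      (¬ IsClassGenerated K.cl2A K.cl3A K.cl7A ∧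
        ¬ IsClassGenerated K.cl2A K.cl3B K.cl7A ∧
        ¬ IsClassGenerated K.cl2B K.cl3A K.cl7A ∧
        ¬ IsClassGenerated K.cl2A K.cl5A K.cl7A ∧
        ¬ IsClassGenerated K.cl3A K.cl5A K.cl7A) := by
  refine ⟨⟨⟨_, _, _, _, _, _, _, hasOrderAndCentralizer_mk orderOf_2A card_centralizer_2A,
    hasOrderAndCentralizer_mk orderOf_2B card_centralizer_2B,
    hasOrderAndCentralizer_mk orderOf_3A card_centralizer_3A,
    hasOrderAndCentralizer_mk orderOf_3B card_centralizer_3B,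
    hasOrderAndCentralizer_mk orderOf_5A card_centralizer_5A,
    hasOrderAndCentralizer_mk orderOf_5C card_centralizer_5C,
    hasOrderAndCentralizer_mk orderOf_7A card_centralizer_7A⟩⟩, fun K => ?_⟩
  have h7 := K.spec7A
  rw [eq_mk_2A K.spec2A, eq_mk_2B K.spec2B]
  refine ⟨⟨?_, ?_, ?_, ?_, ?_, ?_, ?_⟩, ?_, ?_, ?_, ?_, ?_⟩
  · rw [eq_mk_3B K.spec3B]
    exact isClassGenerated_of_exists h7 exists_generators_2B_3B
  -- Both admissible choices of the class need their own generating pair.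
  · rcases eq_mk_5C K.spec5C with h | h <;> rw [h]
    exacts [isClassGenerated_of_exists h7 exists_generators_2A_5C,
      isClassGenerated_of_exists h7 exists_generators_2A_5D]
  · rcases eq_mk_5A K.spec5A with h | h <;> rw [h]
    exacts [isClassGenerated_of_exists h7 exists_generators_2B_5A,
      isClassGenerated_of_exists h7 exists_generators_2B_5B]
  · rcases eq_mk_5C K.spec5C with h | h <;> rw [h]
    exacts [isClassGenerated_of_exists h7 exists_generators_2B_5C,
      isClassGenerated_of_exists h7 exists_generators_2B_5D]
  · rw [eq_mk_3A K.spec3A]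
    rcases eq_mk_5C K.spec5C with h | h <;> rw [h]
    exacts [isClassGenerated_of_exists h7 exists_generators_3A_5C,
      isClassGenerated_of_exists h7 exists_generators_3A_5D]
  · rw [eq_mk_3B K.spec3B]
    rcases eq_mk_5A K.spec5A with h | h <;> rw [h]
    exacts [isClassGenerated_of_exists h7 exists_generators_3B_5A,
      isClassGenerated_of_exists h7 exists_generators_3B_5B]
  · rw [eq_mk_3B K.spec3B]
    rcases eq_mk_5C K.spec5C with h | h <;> rw [h]
    exacts [isClassGenerated_of_exists h7 exists_generators_3B_5C,
      isClassGenerated_of_exists h7 exists_generators_3B_5D]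
  · exact not_isClassGenerated_2A_of_order_three K.spec3A h7
  · exact not_isClassGenerated_2A_of_order_three K.spec3B h7
  · rw [eq_mk_3A K.spec3A]
    exact not_isClassGenerated_2B_3A h7
  · exact not_isClassGenerated_of_classCheck classCheck_2A K.spec5A (by norm_num) h7
  · rw [eq_mk_3A K.spec3A]
    exact not_isClassGenerated_of_classCheck classCheck_3A K.spec5A (by norm_num) h7
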